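/- **Setting.** *Gödel's system* $T$ is the simply typed $\lambda$-calculus with types built from $\mathtt N,\mathtt{Bool}$ by $\times,\to$, pairs and projections $\pi_0,\pi_1$, $0$, $\mathsf S$, $\mathsf{True}$, $\mathsf{False}$, conditional $\mathtt{if}$ and primitive recursor $\mathsf R$ at all types; $=$ is provable equality (the congruence generated by the usual reductions), and $p_0=\pi_0$, $p_1=\lambda x.\pi_0(\pi_1x)$, $p_2=\lambda x.\pi_1(\pi_1 x)$. A *$k$-ary predicate* is a closed normal term $P:\mathtt N^k\to\mathtt{Bool}$ of $T$. An *atom* is a triple $\langle P,\vec n,m\rangle$ with $P$ a $(k+1)$-ary predicate, $\vec n,m$ numerals and $P\vec n m=\mathsf{True}$ in $T$; two atoms $\langle P,\vec n,m\rangle$, $\langle P,\vec n,m'\rangle$ are inconsistent if $m\neq m'$, and all other pairs are consistent. A *state* is a finite set of pairwise consistent atoms. $S_1\,\mathcal U\,S_2$ is $S_1\cup S_2$ minus the atoms of $S_2$ inconsistent with some atom of $S_1$. $\mathcal T_{\mathrm{Learn}}$ extends $T$ by an atomic type $\mathtt S$, a constant $s:\mathtt S$ for each state (we identify $s$ with that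 state; $\varnothing$ denotes the empty one), and, for all $(k+1)$-ary $P$, constants $\chi_P:\mathtt S\to\mathtt N^k\to\mathtt{Bool}$, $\varphi_P:\mathtt S\to\mathtt N^k\to\mathtt N$, $\mathsf{add}_P:\mathtt S\to\mathtt N^{k+1}\to\mathtt S$, $\Cup:\mathtt S\to\mathtt S\to\mathtt S$, with the rules: $\chi_Ps\vec n\mapsto\mathsf{True}$ and $\varphi_Ps\vec n\mapsto m$ if $\langle P,\vec n,m\rangle\in s$; $\chi_Ps\vec n\mapsto\mathsf{False}$ and $\varphi_Ps\vec n\mapsto 0$ if there is no such $m$; $\mathsf{add}_Ps\vec nm\mapsto\varnothing$ if $\langle P,\vec n,l\rangle\in s$ for some $l$ or $P\vec nm=\mathsf{False}$, and $\mathsf{add}_Ps\vec nm\mapsto\{\langle P,\vec n,m\rangle\}$ otherwise; $s_1\Cup s_2\mapsto s_1\,\mathcal U\,s_2$. $\mathcal T_{\mathrm{Class}}$ extends $T$ by $\mathtt S$, the state constants, $\Cup$, and constants $X_P:\mathtt N^k\to\mathtt{Bool}$ (oracles), $\Phi_P:\mathtt N^k\to\mathtt N$ (Skolem maps), $\mathsf{Add}_P:\mathtt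 N^{k+1}\to\mathtt S$, without new rules. A term of $\mathcal T_{\mathrm{Class}}$ *has state $\varnothing$* if it has no state constant but $\varnothing$. For $t\in\mathcal T_{\mathrm{Class}}$, $t[s]\in\mathcal T_{\mathrm{Learn}}$ is $t$ with $X_P,\Phi_P,\mathsf{Add}_P$ replaced by $\chi_Ps,\varphi_Ps,\mathsf{add}_Ps$. **The theory $\mathrm{HA}+\mathrm{EM}_1$.** Its terms are the terms of $\mathcal T_{\mathrm{Class}}$ of type $\mathtt N$ and state $\varnothing$ whose free variables have type $\mathtt N$. Atomic formulas are $Qt_1\cdots t_m$ with $Q:\mathtt N^m\to\mathtt{Bool}$ a closed term of $\mathcal T_{\mathrm{Class}}$ of state $\varnothing$ and $t_i$ terms of the theory; formulas are built by $\land,\lor,\to,\forall,\exists$. $A[s]$ is $A$ with its terms and predicates approximated at $s$. The type $|A|$ of realizers is $\mathtt S$ for $A$ atomic, $|A\land B|=|A|\times|B|$, $|A\lor B|=\mathtt{Bool}\times(|A|\times|B|)$, $|A\to B|=|A|\to|B|$, $|\forall xA|=\mathtt N\to|A|$, $|\exists xA|=\mathtt N\times|A|$. Proofs are natural deduction proofs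 with the rules below; the *decorated term* $\mathcal D^*$ of a proof $\mathcal D$ is a term of $\mathcal T_{\mathrm{Class}}$ of state $\varnothing$ defined by recursion on $\mathcal D$: * free assumption $A$ labelled $x$: $x^{|A|}$; $\land$I: $\langle u,t\rangle$; $\land$E: $\pi_iu$; $\to$I: $\lambda x^{|A|}u$; $\to$E: $ut$; * $\lor$I: $\langle\mathsf{True},\langle u,d\rangle\rangle$ or $\langle\mathsf{False},\langle d,u\rangle\rangle$ with $d$ a dummy closed term; $\lor$E: $\mathtt{if}\ p_0u\ \mathtt{then}\ (\lambda x.w_1)(p_1u)\ \mathtt{else}\ (\lambda x.w_2)(p_2u)$; * $\forall$I: $\lambda\alpha.u$; $\forall$E with term $t$: $ut$; $\exists$I with witness $t$: $\langle t,u\rangle$; $\exists$E: $(\lambda\alpha\lambda x.t)(\pi_0u)(\pi_1u)$ (usual eigenvariable conditions); * induction from $A(0)$ and $\forall\alpha.\,A(\alpha)\to A(\mathsf S\alpha)$ to $\forall\alpha A$: $\lambda\alpha.\mathsf R\,u\,v\,\alpha$; * Post rules from atomic premises to an atomic conclusion (the axioms of equality and ordering on $\mathtt N$, including those for $0$ and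 $\mathsf S$, the equations of $T$, and the tautological consequences, atomic formulas being read up to equality in $T$): $u_1\Cup\cdots\Cup u_m$, which is $\varnothing$ if there is no premise; * the axioms $\forall\vec x.\,\exists yP(\vec x,y)\lor\forall y\,\neg P(\vec x,y)$ (with $\neg P(\vec x,y)$ atomic): $\lambda\vec\alpha.\langle X_P\vec\alpha,\langle\langle\Phi_P\vec\alpha,\varnothing\rangle,\lambda n.\mathsf{Add}_P\vec\alpha n\rangle\rangle$; * the atomic axioms $P(\vec t,t)\Rightarrow X_P\vec t$: $\mathsf{Add}_P\vec t\,t$; and $X_P\vec t\Rightarrow P(\vec t,\Phi_P\vec t)$: $\varnothing$. **Realizability.** For a state $s$, a closed formula $A[s]$ and a closed term $t:|A|$ of $\mathcal T_{\mathrm{Learn}}$, with $=$ denoting provable equality in $\mathcal T_{\mathrm{Learn}}$, $t\Vdash_sA[s]$ is defined by: for $A$ atomic, $t=\varnothing$ implies $A[s]=\mathsf{True}$; $t\Vdash_sB\land C$ iff $\pi_0t\Vdash_sB$ and $\pi_1t\Vdash_sC$; $t\Vdash_sB\lor C$ iff $p_0t=\mathsf{True}$ and $p_1t\Vdash_sB$,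 or $p_0t=\mathsf{False}$ and $p_2t\Vdash_sC$; $t\Vdash_sB\to C$ iff $u\Vdash_sB$ implies $tu\Vdash_sC$ for all $u$ of the form $u'[s]$, with $u'$ a closed term of $\mathcal T_{\mathrm{Class}}$ of state $\varnothing$; $t\Vdash_s\forall xB$ iff $tn\Vdash_sB[n/x]$ for all numerals $n$; $t\Vdash_s\exists xB$ iff $\pi_0t=n$ and $\pi_1t\Vdash_sB[n/x]$ for some numeral $n$. For closed $A$ and closed $t:|A|$ in $\mathcal T_{\mathrm{Class}}$ of state $\varnothing$, $t\Vvdash_s A$ is defined by the same clauses, with the approximations at $s$ taken in the equations (for $A$ atomic, $t[s]=\varnothing$ implies $A[s]=\mathsf{True}$; $p_0t[s]=\mathsf{True}$; $\pi_0t[s]=n$; and so on) and $u$ in the clause for $\to$ ranging over the closed terms of $\mathcal T_{\mathrm{Class}}$ of state $\varnothing$. Finally $t\Vvdash A$ means that $t\Vvdash_sA$ for every state $s$. **Theorem.** 1. (Adequacy.) Let $\mathcal D$ be a proof of $A$ in $\mathrm{HA}+\mathrm{EM}_1$ with free assumptions $x_1^{A_1},\dots,x_r^{A_r}$ and free variables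 $\alpha_1,\dots,\alpha_k:\mathtt N$, and let $w=\mathcal D^*$. For all state constants $s$, all numerals $n_1,\dots,n_k$ and all closed terms $t_i:|A_i|$ of $\mathcal T_{\mathrm{Class}}$ of state $\varnothing$, if $t_i[s]\Vdash_sA_i[\vec n/\vec\alpha][s]$ for $i=1,\dots,r$, then $$w[t_1/x_1\cdots t_r/x_r\ n_1/\alpha_1\cdots n_k/\alpha_k][s]\ \Vdash_s\ A[n_1/\alpha_1\cdots n_k/\alpha_k][s].$$ 2. If $\mathcal D$ is a proof of a closed formula $A$ without free assumptions and free variables, then $\mathcal D^*\Vvdash A$. 3. (Realizability.) If $A$ is a closed formula provable in $\mathrm{HA}+\mathrm{EM}_1$, then there is a closed term $t$ of $\mathcal T_{\mathrm{Class}}$ (of state $\varnothing$) with $t\Vvdash A$. -/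

import Mathlib

namespace HAEM1

/-! ## Types and terms -/

/-- Types of Gödel's system `T` over the atomic types `nat`, `bool` and `state`. -/
inductive Ty : Type
  | nat : Ty
  | bool : Ty
  | state : Ty
  | prod (A B : Ty) : Ty
  | arrow (A B : Ty) : Ty

infixr:60 " ⇾ " => Ty.arrow

/-- The types of system `T` proper: those in which `state` does not occur. -/
def Ty.StateFree : Ty → Prop
  | .nat => True
  | .bool => True
  | .state => False
  | .prod A B => A.StateFree ∧ B.StateFree
  | .arrow A B => A.StateFree ∧ B.StateFree

/-- `natArrow k A` is `nat → ⋯ → nat → A` with `k` arguments. -/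
@[reducible] def natArrow : ℕ → Ty → Ty
  | 0, A => A
  | k + 1, A => natArrow k (.nat ⇾ A)

abbrev Ctx := List Ty

/-- The context of `n` variables of type `nat`. -/
@[reducible] def nats : ℕ → Ctx
  | 0 => []
  | n + 1 => .nat :: nats n

/-- Typed de Bruijn variables. -/
inductive Var : Ctx → Ty → Type
  | zero {Γ : Ctx} {A : Ty} : Var (A :: Γ) A
  | succ {Γ : Ctx} {A B : Ty} (x : Var Γ A) : Var (B :: Γ) A

/-- Terms of type `A` of system `T` extended by a family `K` of typed constants, with free variables
in a context (terms are taken up to renaming of bound variables). -/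
inductive Tm (K : Ty → Type) : Ctx → Ty → Type
  | var {Γ : Ctx} {A : Ty} (x : Var Γ A) : Tm K Γ A
  | const {Γ : Ctx} {A : Ty} (c : K A) : Tm K Γ A
  | zero {Γ : Ctx} : Tm K Γ .nat
  | suc {Γ : Ctx} (t : Tm K Γ .nat) : Tm K Γ .nat
  | tt {Γ : Ctx} : Tm K Γ .bool
  | ff {Γ : Ctx} : Tm K Γ .bool
  | ite {Γ : Ctx} (A : Ty) : Tm K Γ (.bool ⇾ A ⇾ A ⇾ A)
  | recN {Γ : Ctx} (A : Ty) : Tm K Γ (A ⇾ (.nat ⇾ A ⇾ A) ⇾ .nat ⇾ A)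
  | app {Γ : Ctx} {A B : Ty} (t : Tm K Γ (A ⇾ B)) (u : Tm K Γ A) : Tm K Γ B
  | lam {Γ : Ctx} {A B : Ty} (t : Tm K (A :: Γ) B) : Tm K Γ (A ⇾ B)
  | pair {Γ : Ctx} {A B : Ty} (t : Tm K Γ A) (u : Tm K Γ B) : Tm K Γ (.prod A B)
  | fst {Γ : Ctx} {A B : Ty} (t : Tm K Γ (.prod A B)) : Tm K Γ A
  | snd {Γ : Ctx} {A B : Ty} (t : Tm K Γ (.prod A B)) : Tm K Γ B

/-! ### Renaming and substitution -/

abbrev Ren (Γ Δ : Ctx) := ∀ ⦃A : Ty⦄, Var Γ A → Var Δ A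

def Ren.lift {Γ Δ : Ctx} {B : Ty} (ρ : Ren Γ Δ) : Ren (B :: Γ) (B :: Δ)
  | _, .zero => .zero
  | _, .succ x => .succ (ρ x)

/-- The renaming `ρ` followed by the passage to a context with one more variable. -/
def Ren.wk {Γ Δ : Ctx} {B : Ty} (ρ : Ren Γ Δ) : Ren Γ (B :: Δ) := fun _ x => .succ (ρ x)

def Ren.inl : ∀ {Γ Δ : Ctx}, Ren Γ (Γ ++ Δ)
  | _ :: _, _, _, .zero => .zero
  | _ :: _, _, _, .succ x => .succ (Ren.inl x)

def Ren.inr : ∀ {Γ Δ : Ctx}, Ren Δ (Γ ++ Δ)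
  | [], _, _, x => x
  | _ :: Γ, _, _, x => .succ (Ren.inr (Γ := Γ) x)

variable {K K' : Ty → Type}

def Tm.rename : ∀ {Γ Δ : Ctx} {A : Ty}, Tm K Γ A → Ren Γ Δ → Tm K Δ A
  | _, _, _, .var x, ρ => .var (ρ x)
  | _, _, _, .const c, _ => .const c
  | _, _, _, .zero, _ => .zero
  | _, _, _, .suc t, ρ => .suc (t.rename ρ)
  | _, _, _, .tt, _ => .tt
  | _, _, _, .ff, _ => .ff
  | _, _, _, .ite A, _ => .ite A
  | _, _, _, .recN A, _ => .recN A
  | _, _, _, .app t u, ρ => .app (t.rename ρ) (u.rename ρ)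
  | _, _, _, .lam t, ρ => .lam (t.rename ρ.lift)
  | _, _, _, .pair t u, ρ => .pair (t.rename ρ) (u.rename ρ)
  | _, _, _, .fst t, ρ => .fst (t.rename ρ)
  | _, _, _, .snd t, ρ => .snd (t.rename ρ)

/-- A closed term as a term in an arbitrary context. -/
def Tm.ofClosed {Γ : Ctx} {A : Ty} (t : Tm K [] A) : Tm K Γ A := t.rename (fun _ x => nomatch x)

abbrev Subst (K : Ty → Type) (Γ Δ : Ctx) := ∀ ⦃A : Ty⦄, Var Γ A → Tm K Δ A

def Subst.lift {Γ Δ : Ctx} {B : Ty} (σ : Subst K Γ Δ) : Subst K (B :: Γ) (B :: Δ)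
  | _, .zero => .var .zero
  | _, .succ x => (σ x).rename (fun _ y => .succ y)

/-- Simultaneous capture-avoiding substitution. -/
def Tm.subst : ∀ {Γ Δ : Ctx} {A : Ty}, Tm K Γ A → Subst K Γ Δ → Tm K Δ A
  | _, _, _, .var x, σ => σ x
  | _, _, _, .const c, _ => .const c
  | _, _, _, .zero, _ => .zero
  | _, _, _, .suc t, σ => .suc (t.subst σ)
  | _, _, _, .tt, _ => .tt
  | _, _, _, .ff, _ => .ff
  | _, _, _, .ite A, _ => .ite A
  | _, _, _, .recN A, _ => .recN A
  | _, _, _, .app t u, σ => .app (t.subst σ) (u.subst σ)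
  | _, _, _, .lam t, σ => .lam (t.subst σ.lift)
  | _, _, _, .pair t u, σ => .pair (t.subst σ) (u.subst σ)
  | _, _, _, .fst t, σ => .fst (t.subst σ)
  | _, _, _, .snd t, σ => .snd (t.subst σ)

/-- The substitution of `u` for the last variable. -/
def Subst.inst {Γ : Ctx} {B : Ty} (u : Tm K Γ B) : Subst K (B :: Γ) Γ
  | _, .zero => u
  | _, .succ x => .var x

/-- The substitution of `suc α` for the last variable `α`. -/
def Subst.sucLast {Γ : Ctx} : Subst K (.nat :: Γ) (.nat :: Γ)
  | _, .zero => .suc (.var .zero)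
  | _, .succ x => .var (.succ x)

def Subst.append : ∀ {Γ Δ Θ : Ctx}, Subst K Γ Θ → Subst K Δ Θ → Subst K (Γ ++ Δ) Θ
  | [], _, _, _, τ, _, x => τ x
  | _ :: _, _, _, σ, _, _, .zero => σ .zero
  | _ :: _, _, _, σ, τ, _, .succ x => Subst.append (fun _ y => σ (.succ y)) τ x

/-- The term obtained by replacing each constant `c` by the closed term `f c`. -/
def Tm.replaceConst (f : ∀ ⦃A : Ty⦄, K A → Tm K' [] A) :
    ∀ {Γ : Ctx} {A : Ty}, Tm K Γ A → Tm K' Γ A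
  | _, _, .var x => .var x
  | _, _, .const c => (f c).ofClosed
  | _, _, .zero => .zero
  | _, _, .suc t => .suc (t.replaceConst f)
  | _, _, .tt => .tt
  | _, _, .ff => .ff
  | _, _, .ite A => .ite A
  | _, _, .recN A => .recN A
  | _, _, .app t u => .app (t.replaceConst f) (u.replaceConst f)
  | _, _, .lam t => .lam (t.replaceConst f)
  | _, _, .pair t u => .pair (t.replaceConst f) (u.replaceConst f)
  | _, _, .fst t => .fst (t.replaceConst f)
  | _, _, .snd t => .snd (t.replaceConst f)

/-! ### Notational abbreviations for terms -/

/-- The numeral denoting `n`. -/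
def num {Γ : Ctx} : ℕ → Tm K Γ .nat
  | 0 => .zero
  | n + 1 => .suc (num n)

def boolTm {Γ : Ctx} : Bool → Tm K Γ .bool
  | true => .tt
  | false => .ff

/-- `apps k t ts` is `t ts₀ ⋯ tsₖ₋₁`. -/
def apps {Γ : Ctx} : ∀ (k : ℕ) {A : Ty}, Tm K Γ (natArrow k A) → (Fin k → Tm K Γ .nat) → Tm K Γ A
  | 0, _, t, _ => t
  | k + 1, A, t, ts =>
    .app (apps k (A := .nat ⇾ A) t (fun i => ts i.castSucc)) (ts (Fin.last k))

/-- `lams k t` is `λ x₁ ⋯ λ xₖ, t`, where `x₁, …, xₖ` are the variables of the context `nats k`. -/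
def lams : ∀ (k : ℕ) {A : Ty}, Tm K (nats k) A → Tm K [] (natArrow k A)
  | 0, _, t => t
  | k + 1, _, t => lams k (.lam t)

/-- The variables `x₁, …, xₖ` of the context `nats k`, in the order in which `lams` binds them. -/
def natVars : ∀ (k : ℕ), Fin k → Tm K (nats k) .nat
  | 0 => Fin.elim0
  | k + 1 => Fin.snoc (α := fun _ => Tm K (nats (k + 1)) .nat)
      (fun i => (natVars k i).rename (fun _ x => .succ x)) (.var .zero)

/-- The substitution of numerals for all variables of `nats n`. -/
def numSub {Δ : Ctx} : ∀ {n : ℕ}, (Fin n → ℕ) → Subst K (nats n) Δ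
  | _ + 1, m, _, .zero => num (m 0)
  | _ + 1, m, _, .succ x => numSub (fun i => m i.succ) x

/-- `if b then t else u`. -/
def Tm.cond {Γ : Ctx} {A : Ty} (b : Tm K Γ .bool) (t u : Tm K Γ A) : Tm K Γ A :=
  .app (.app (.app (.ite A) b) t) u

/-- The ternary projections `p₀ = π₀`, `p₁ = λ x, π₀ (π₁ x)`, `p₂ = λ x, π₁ (π₁ x)`. -/
def Tm.p0 {Γ : Ctx} {A B C : Ty} (t : Tm K Γ (.prod A (.prod B C))) : Tm K Γ A := .fst t

def Tm.p1 {Γ : Ctx} {A B C : Ty} (t : Tm K Γ (.prod A (.prod B C))) : Tm K Γ B :=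
  .app (.lam (.fst (.snd (.var .zero)))) t

def Tm.p2 {Γ : Ctx} {A B C : Ty} (t : Tm K Γ (.prod A (.prod B C))) : Tm K Γ C :=
  .app (.lam (.snd (.snd (.var .zero)))) t

/-! Terms of `T` implementing the boolean connectives. -/

def Tm.bnot {Γ : Ctx} (b : Tm K Γ .bool) : Tm K Γ .bool :=
  .app (.lam (Tm.cond (.var .zero) .ff .tt)) b

def Tm.band {Γ : Ctx} (b c : Tm K Γ .bool) : Tm K Γ .bool :=
  .app (.app (.lam (.lam (Tm.cond (.var (.succ .zero)) (.var .zero) .ff))) b) c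

def Tm.bor {Γ : Ctx} (b c : Tm K Γ .bool) : Tm K Γ .bool :=
  .app (.app (.lam (.lam (Tm.cond (.var (.succ .zero)) .tt (.var .zero)))) b) c

def Tm.bimp {Γ : Ctx} (b c : Tm K Γ .bool) : Tm K Γ .bool :=
  .app (.app (.lam (.lam (Tm.cond (.var (.succ .zero)) (.var .zero) .tt))) b) c

/-- The term of `T` deciding equality on `nat`: `eq 0 0 = True`, `eq 0 (y + 1) = False`,
`eq (x + 1) 0 = False`, `eq (x + 1) (y + 1) = eq x y`. -/
def eqTm : Tm K [] (.nat ⇾ .nat ⇾ .bool) :=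
  .app (.app (.recN (.nat ⇾ .bool))
    (.lam (.app (.app (.app (.recN .bool) .tt) (.lam (.lam .ff))) (.var .zero))))
    (.lam (.lam (.lam (.app (.app (.app (.recN .bool) .ff)
      (.lam (.lam (.app (.var (.succ (.succ (.succ .zero)))) (.var (.succ .zero))))))
      (.var .zero)))))

/-- The term of `T` deciding `≤` on `nat`: `le 0 y = True`, `le (x + 1) 0 = False`,
`le (x + 1) (y + 1) = le x y`. -/
def leTm : Tm K [] (.nat ⇾ .nat ⇾ .bool) :=
  .app (.app (.recN (.nat ⇾ .bool)) (.lam .tt))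
    (.lam (.lam (.lam (.app (.app (.app (.recN .bool) .ff)
      (.lam (.lam (.app (.var (.succ (.succ (.succ .zero)))) (.var (.succ .zero))))))
      (.var .zero)))))

/-! ### Reduction and equational theory -/

/-- Contraction of a redex of system `T`. -/
inductive Contract : ∀ {Γ : Ctx} {A : Ty}, Tm K Γ A → Tm K Γ A → Prop
  | beta {Γ : Ctx} {A B : Ty} (t : Tm K (A :: Γ) B) (u : Tm K Γ A) :
      Contract (.app (.lam t) u) (t.subst (Subst.inst u))
  | fst {Γ : Ctx} {A B : Ty} (t : Tm K Γ A) (u : Tm K Γ B) : Contract (.fst (.pair t u)) t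
  | snd {Γ : Ctx} {A B : Ty} (t : Tm K Γ A) (u : Tm K Γ B) : Contract (.snd (.pair t u)) u
  | recZero {Γ : Ctx} {A : Ty} (u : Tm K Γ A) (v : Tm K Γ (.nat ⇾ A ⇾ A)) :
      Contract (.app (.app (.app (.recN A) u) v) .zero) u
  | recSuc {Γ : Ctx} {A : Ty} (u : Tm K Γ A) (v : Tm K Γ (.nat ⇾ A ⇾ A)) (t : Tm K Γ .nat) :
      Contract (.app (.app (.app (.recN A) u) v) (.suc t))
        (.app (.app v t) (.app (.app (.app (.recN A) u) v) t))
  | iteTrue {Γ : Ctx} {A : Ty} (u v : Tm K Γ A) :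
      Contract (.app (.app (.app (.ite A) .tt) u) v) u
  | iteFalse {Γ : Ctx} {A : Ty} (u v : Tm K Γ A) :
      Contract (.app (.app (.app (.ite A) .ff) u) v) v

/-- One-step reduction of system `T`. -/
inductive Step : ∀ {Γ : Ctx} {A : Ty}, Tm K Γ A → Tm K Γ A → Prop
  | contract {Γ : Ctx} {A : Ty} {t u : Tm K Γ A} : Contract t u → Step t u
  | suc {Γ : Ctx} {t t' : Tm K Γ .nat} : Step t t' → Step (.suc t) (.suc t')
  | appL {Γ : Ctx} {A B : Ty} {t t' : Tm K Γ (A ⇾ B)} {u : Tm K Γ A} :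
      Step t t' → Step (.app t u) (.app t' u)
  | appR {Γ : Ctx} {A B : Ty} {t : Tm K Γ (A ⇾ B)} {u u' : Tm K Γ A} :
      Step u u' → Step (.app t u) (.app t u')
  | lam {Γ : Ctx} {A B : Ty} {t t' : Tm K (A :: Γ) B} : Step t t' → Step (.lam t) (.lam t')
  | pairL {Γ : Ctx} {A B : Ty} {t t' : Tm K Γ A} {u : Tm K Γ B} :
      Step t t' → Step (.pair t u) (.pair t' u)
  | pairR {Γ : Ctx} {A B : Ty} {t : Tm K Γ A} {u u' : Tm K Γ B} :
      Step u u' → Step (.pair t u) (.pair t u')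
  | fst {Γ : Ctx} {A B : Ty} {t t' : Tm K Γ (.prod A B)} : Step t t' → Step (.fst t) (.fst t')
  | snd {Γ : Ctx} {A B : Ty} {t t' : Tm K Γ (.prod A B)} : Step t t' → Step (.snd t) (.snd t')

/-- Provable equality in the equational theory of system `T` extended by the equations `t = u` for
the additional rules `R t u`. -/
inductive Conv (R : ∀ ⦃Γ : Ctx⦄ ⦃A : Ty⦄, Tm K Γ A → Tm K Γ A → Prop) :
    ∀ {Γ : Ctx} {A : Ty}, Tm K Γ A → Tm K Γ A → Prop
  | refl {Γ : Ctx} {A : Ty} (t : Tm K Γ A) : Conv R t t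
  | symm {Γ : Ctx} {A : Ty} {t u : Tm K Γ A} : Conv R t u → Conv R u t
  | trans {Γ : Ctx} {A : Ty} {t u v : Tm K Γ A} : Conv R t u → Conv R u v → Conv R t v
  | suc {Γ : Ctx} {t t' : Tm K Γ .nat} : Conv R t t' → Conv R (.suc t) (.suc t')
  | app {Γ : Ctx} {A B : Ty} {t t' : Tm K Γ (A ⇾ B)} {u u' : Tm K Γ A} :
      Conv R t t' → Conv R u u' → Conv R (.app t u) (.app t' u')
  | lam {Γ : Ctx} {A B : Ty} {t t' : Tm K (A :: Γ) B} :
      Conv R t t' → Conv R (.lam t) (.lam t')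
  | pair {Γ : Ctx} {A B : Ty} {t t' : Tm K Γ A} {u u' : Tm K Γ B} :
      Conv R t t' → Conv R u u' → Conv R (.pair t u) (.pair t' u')
  | fst {Γ : Ctx} {A B : Ty} {t t' : Tm K Γ (.prod A B)} :
      Conv R t t' → Conv R (.fst t) (.fst t')
  | snd {Γ : Ctx} {A B : Ty} {t t' : Tm K Γ (.prod A B)} :
      Conv R t t' → Conv R (.snd t) (.snd t')
  | contract {Γ : Ctx} {A : Ty} {t u : Tm K Γ A} : Contract t u → Conv R t u
  | rule {Γ : Ctx} {A : Ty} {t u : Tm K Γ A} : R t u → Conv R t u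

/-- Provable equality with no rule besides those of system `T`. -/
abbrev EqT {Γ : Ctx} {A : Ty} (t u : Tm K Γ A) : Prop := Conv (fun _ _ _ _ => False) t u

/-! ## Predicates of system `T`, states of knowledge -/

/-- The empty family of constants. -/
def NoConst : Ty → Type := fun _ => Empty

/-- The type `state` occurs nowhere in the term. -/
def Tm.StateFree : ∀ {Γ : Ctx} {A : Ty}, Tm K Γ A → Prop
  | _, A, .var _ => A.StateFree
  | _, A, .const _ => A.StateFree
  | _, _, .zero => True
  | _, _, .suc t => t.StateFree
  | _, _, .tt => True
  | _, _, .ff => True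
  | _, _, .ite A => A.StateFree
  | _, _, .recN A => A.StateFree
  | _, _, .app t u => t.StateFree ∧ u.StateFree
  | _, _, .lam (A := A) t => A.StateFree ∧ t.StateFree
  | _, _, .pair t u => t.StateFree ∧ u.StateFree
  | _, _, .fst t => t.StateFree
  | _, _, .snd t => t.StateFree

def Tm.Normal {Γ : Ctx} {A : Ty} (t : Tm K Γ A) : Prop := ∀ u, ¬ Step t u

/-- A `k`-ary predicate of `T`: a closed normal term `nat → ⋯ → nat → bool` of system `T`. -/
structure Pred (k : ℕ) where
  tm : Tm NoConst [] (natArrow k .bool)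
  stateFree : tm.StateFree
  normal : tm.Normal

/-- A predicate of `T` as a term over any family of constants. -/
def Pred.toTm {k : ℕ} {Γ : Ctx} (P : Pred k) : Tm K Γ (natArrow k .bool) :=
  Tm.ofClosed (P.tm.replaceConst (fun _ c => nomatch c))

/-- The term `P n⃗ m` of system `T`. -/
def Pred.at {k : ℕ} (P : Pred (k + 1)) (n : Fin k → ℕ) (m : ℕ) : Tm NoConst [] .bool :=
  .app (apps k (A := .nat ⇾ .bool) P.tm (fun i => num (n i))) (num m)

/-- A predicate together with all its arguments but the last one. -/
abbrev Key := Σ k : ℕ, Pred (k + 1) × (Fin k → ℕ)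

/-- Atoms `⟨P, n⃗, m⟩`, with `P n⃗ m = True` in `T`. -/
structure EMAtom where
  k : ℕ
  P : Pred (k + 1)
  n : Fin k → ℕ
  m : ℕ
  holds : EqT (P.at n m) .tt

def EMAtom.key (a : EMAtom) : Key := ⟨a.k, a.P, a.n⟩

def EMAtom.Consistent (a b : EMAtom) : Prop := a.key = b.key → a.m = b.m

/-- States of knowledge: finite sets of pairwise consistent atoms. -/
structure KState where
  atoms : Set EMAtom
  finite : atoms.Finite
  consistent : ∀ a ∈ atoms, ∀ b ∈ atoms, a.Consistent b

def KState.empty : KState := ⟨∅, Set.finite_empty, by simp⟩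

def KState.single (a : EMAtom) : KState :=
  ⟨{a}, Set.finite_singleton a, by
    intro x hx y hy _
    rw [Set.mem_singleton_iff.1 hx, Set.mem_singleton_iff.1 hy]⟩

/-- The consistent union: `S₁ ∪ S₂` minus the atoms of `S₂` inconsistent with some atom of `S₁`. -/
def KState.cup (S₁ S₂ : KState) : KState where
  atoms := S₁.atoms ∪ {a ∈ S₂.atoms | ∀ b ∈ S₁.atoms, a.Consistent b}
  finite := S₁.finite.union (S₂.finite.subset (Set.sep_subset _ _))
  consistent := by
    rintro a (ha | ⟨ha, ha'⟩) b (hb | ⟨hb, hb'⟩)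
    · exact S₁.consistent a ha b hb
    · exact fun h => (hb' a ha h.symm).symm
    · exact ha' b hb
    · exact S₂.consistent a ha b hb

/-- The state knows a witness for the given predicate and arguments. -/
def KState.Knows (S : KState) (κ : Key) : Prop := ∃ a ∈ S.atoms, a.key = κ

/-! ## The systems `T_Class` and `T_Learn` -/

/-- The constants of `T_Class` that occur in terms of state `∅`: the oracles `Χ_P`, the Skolem maps
`Φ_P`, the maps `Add_P`, the union, and the state constant `∅`. -/
inductive ClassConst : Ty → Type
  | empty : ClassConst .state
  | cup : ClassConst (.state ⇾ .state ⇾ .state)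
  | Chi {k : ℕ} (P : Pred (k + 1)) : ClassConst (natArrow k .bool)
  | Phi {k : ℕ} (P : Pred (k + 1)) : ClassConst (natArrow k .nat)
  | Add {k : ℕ} (P : Pred (k + 1)) : ClassConst (natArrow (k + 1) .state)

/-- The constants of `T_Learn`: one constant for each state, and `χ_P`, `φ_P`, `add_P`, union. -/
inductive LearnConst : Ty → Type
  | st (S : KState) : LearnConst .state
  | cup : LearnConst (.state ⇾ .state ⇾ .state)
  | chi {k : ℕ} (P : Pred (k + 1)) : LearnConst (.state ⇾ natArrow k .bool)
  | phi {k : ℕ} (P : Pred (k + 1)) : LearnConst (.state ⇾ natArrow k .nat)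
  | add {k : ℕ} (P : Pred (k + 1)) : LearnConst (.state ⇾ natArrow (k + 1) .state)

/-- Terms of `T_Class` of state `∅`. There are no reduction rules for the constants. -/
abbrev TClass := Tm ClassConst

/-- Terms of `T_Learn`. -/
abbrev TLearn := Tm LearnConst

def stTm {Γ : Ctx} (S : KState) : TLearn Γ .state := .const (.st S)

/-- The reduction rules for the constants of `T_Learn`. -/
inductive LearnRule : ∀ ⦃Γ : Ctx⦄ ⦃A : Ty⦄, TLearn Γ A → TLearn Γ A → Prop
  | chiTrue {Γ : Ctx} {k : ℕ} (P : Pred (k + 1)) (S : KState) (n : Fin k → ℕ) :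
      S.Knows ⟨k, P, n⟩ →
      LearnRule (Γ := Γ) (apps k (.app (.const (.chi P)) (stTm S)) (fun i => num (n i))) .tt
  | chiFalse {Γ : Ctx} {k : ℕ} (P : Pred (k + 1)) (S : KState) (n : Fin k → ℕ) :
      ¬ S.Knows ⟨k, P, n⟩ →
      LearnRule (Γ := Γ) (apps k (.app (.const (.chi P)) (stTm S)) (fun i => num (n i))) .ff
  | phiFound {Γ : Ctx} (S : KState) (a : EMAtom) :
      a ∈ S.atoms →
      LearnRule (Γ := Γ) (apps a.k (.app (.const (.phi a.P)) (stTm S)) (fun i => num (a.n i)))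
        (num a.m)
  | phiZero {Γ : Ctx} {k : ℕ} (P : Pred (k + 1)) (S : KState) (n : Fin k → ℕ) :
      ¬ S.Knows ⟨k, P, n⟩ →
      LearnRule (Γ := Γ) (apps k (.app (.const (.phi P)) (stTm S)) (fun i => num (n i))) .zero
  | addEmpty {Γ : Ctx} {k : ℕ} (P : Pred (k + 1)) (S : KState) (n : Fin k → ℕ) (m : ℕ) :
      S.Knows ⟨k, P, n⟩ ∨ EqT (P.at n m) .ff →
      LearnRule (Γ := Γ)
        (.app (apps k (A := .nat ⇾ .state) (.app (.const (.add P)) (stTm S))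
          (fun i => num (n i))) (num m))
        (stTm KState.empty)
  | addNew {Γ : Ctx} {k : ℕ} (P : Pred (k + 1)) (S : KState) (n : Fin k → ℕ) (m : ℕ)
      (h : EqT (P.at n m) .tt) :
      ¬ S.Knows ⟨k, P, n⟩ →
      LearnRule (Γ := Γ)
        (.app (apps k (A := .nat ⇾ .state) (.app (.const (.add P)) (stTm S))
          (fun i => num (n i))) (num m))
        (stTm (KState.single ⟨k, P, n, m, h⟩))
  | cup {Γ : Ctx} (S₁ S₂ : KState) :
      LearnRule (Γ := Γ) (.app (.app (.const .cup) (stTm S₁)) (stTm S₂)) (stTm (S₁.cup S₂))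

/-- Provable equality in `T_Learn`. -/
abbrev EqLearn {Γ : Ctx} {A : Ty} (t u : TLearn Γ A) : Prop := Conv LearnRule t u

def approxConst (s : KState) : ∀ ⦃A : Ty⦄, ClassConst A → TLearn [] A
  | _, .empty => stTm KState.empty
  | _, .cup => .const .cup
  | _, .Chi P => .app (.const (.chi P)) (stTm s)
  | _, .Phi P => .app (.const (.phi P)) (stTm s)
  | _, .Add P => .app (.const (.add P)) (stTm s)

/-- The approximation `t[s]` of `t` at state `s`: the constants `Χ_P`, `Φ_P`, `Add_P` are replaced by
`χ_P s`, `φ_P s`, `add_P s`. -/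
def Tm.approx (s : KState) {Γ : Ctx} {A : Ty} (t : TClass Γ A) : TLearn Γ A :=
  t.replaceConst (approxConst s)

/-! ## Formulas -/

/-- Terms of the form `Q t₁ ⋯ tₘ` with `Q` closed and `t₁, …, tₘ` of type `nat`. -/
inductive PredApp {Γ : Ctx} : ∀ {A : Ty}, Tm K Γ A → Prop
  | closed {A : Ty} (Q : Tm K [] A) : PredApp Q.ofClosed
  | app {A : Ty} {t : Tm K Γ (.nat ⇾ A)} (u : Tm K Γ .nat) : PredApp t → PredApp (.app t u)

/-! Helper facts: such terms are stable under substitution and replacement of constants. -/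

theorem Ren.lift_comp {Γ Δ Θ : Ctx} {B : Ty} (ρ : Ren Γ Δ) (ρ' : Ren Δ Θ) :
    (fun _ x => ρ'.lift (ρ.lift x) : Ren (B :: Γ) (B :: Θ)) = Ren.lift (fun _ x => ρ' (ρ x)) := by
  funext A x
  cases x <;> rfl

theorem Tm.rename_rename {Γ Δ Θ : Ctx} {A : Ty} (t : Tm K Γ A) (ρ : Ren Γ Δ) (ρ' : Ren Δ Θ) :
    (t.rename ρ).rename ρ' = t.rename (fun _ x => ρ' (ρ x)) := by
  induction t generalizing Δ Θ <;> simp_all [Tm.rename, Ren.lift_comp]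

theorem Subst.lift_ren {Γ Δ Θ : Ctx} {B : Ty} (ρ : Ren Γ Δ) (σ : Subst K Δ Θ) :
    (fun _ x => σ.lift (ρ.lift x) : Subst K (B :: Γ) (B :: Θ)) = Subst.lift (fun _ x => σ (ρ x)) := by
  funext A x
  cases x <;> rfl

theorem Tm.subst_rename {Γ Δ Θ : Ctx} {A : Ty} (t : Tm K Γ A) (ρ : Ren Γ Δ) (σ : Subst K Δ Θ) :
    (t.rename ρ).subst σ = t.subst (fun _ x => σ (ρ x)) := by
  induction t generalizing Δ Θ <;> simp_all [Tm.rename, Tm.subst, Subst.lift_ren]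

theorem Subst.lift_var {Γ Δ : Ctx} {B : Ty} (ρ : Ren Γ Δ) :
    (Subst.lift (fun _ x => .var (ρ x)) : Subst K (B :: Γ) (B :: Δ)) = fun _ x => .var (ρ.lift x) := by
  funext A x
  cases x <;> rfl

theorem Tm.subst_var {Γ Δ : Ctx} {A : Ty} (t : Tm K Γ A) (ρ : Ren Γ Δ) :
    t.subst (fun _ x => .var (ρ x)) = t.rename ρ := by
  induction t generalizing Δ <;> simp_all [Tm.rename, Tm.subst, Subst.lift_var]

theorem Tm.ofClosed_subst {Γ Δ : Ctx} {A : Ty} (t : Tm K [] A) (σ : Subst K Γ Δ) :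
    (t.ofClosed : Tm K Γ A).subst σ = t.ofClosed := by
  rw [Tm.ofClosed, Tm.subst_rename, Tm.ofClosed, ← Tm.subst_var]
  congr 1
  funext A x
  cases x

theorem Tm.ofClosed_rename {Γ Δ : Ctx} {A : Ty} (t : Tm K [] A) (ρ : Ren Γ Δ) :
    (t.ofClosed : Tm K Γ A).rename ρ = t.ofClosed := by
  rw [Tm.ofClosed, Tm.rename_rename, Tm.ofClosed]
  congr 1
  funext A x
  cases x

theorem Tm.replaceConst_rename (f : ∀ ⦃A : Ty⦄, K A → Tm K' [] A) {Γ Δ : Ctx} {A : Ty}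
    (t : Tm K Γ A) (ρ : Ren Γ Δ) :
    (t.rename ρ).replaceConst f = (t.replaceConst f).rename ρ := by
  induction t generalizing Δ <;> simp_all [Tm.rename, Tm.replaceConst, Tm.ofClosed_rename]

theorem PredApp.subst {Γ Δ : Ctx} {A : Ty} {t : Tm K Γ A} (h : PredApp t) (σ : Subst K Γ Δ) :
    PredApp (t.subst σ) := by
  induction h with
  | closed Q => rw [Tm.ofClosed_subst]; exact .closed Q
  | app u _ ih => exact .app _ ih

theorem PredApp.replaceConst (f : ∀ ⦃A : Ty⦄, K A → Tm K' [] A) {Γ : Ctx} {A : Ty} {t : Tm K Γ A}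
    (h : PredApp t) : PredApp (t.replaceConst f) := by
  induction h with
  | closed Q => rw [Tm.ofClosed, Tm.replaceConst_rename]; exact .closed _
  | app u _ ih => exact .app _ ih

theorem PredApp.apps {Γ : Ctx} : ∀ (k : ℕ) {A : Ty} {t : Tm K Γ (natArrow k A)}
    (ts : Fin k → Tm K Γ .nat), PredApp t → PredApp (HAEM1.apps k t ts)
  | 0, _, _, _, h => h
  | k + 1, A, _, ts, h => .app _ (PredApp.apps k (A := .nat ⇾ A) (fun i => ts i.castSucc) h)

/-- Atomic formulas in `n` free variables of type `nat`: terms `Q t₁ ⋯ tₘ` of type `bool`, with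
`Q : nat → ⋯ → nat → bool` closed. -/
abbrev Atomic (K : Ty → Type) (n : ℕ) := {b : Tm K (nats n) .bool // PredApp b}

/-- The atomic formula `Q t₁ ⋯ tₘ`. -/
def Atomic.mk {m n : ℕ} (Q : Tm K [] (natArrow m .bool)) (ts : Fin m → Tm K (nats n) .nat) :
    Atomic K n :=
  ⟨apps m Q.ofClosed ts, PredApp.apps m ts (.closed Q)⟩

def Atomic.subst {n m : ℕ} (b : Atomic K n) (σ : Subst K (nats n) (nats m)) : Atomic K m :=
  ⟨b.1.subst σ, b.2.subst σ⟩

/-- `Formula K n τ` consists of the formulas `A` over the constants `K`, with `n` free variables (of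
type `nat`), whose type of realizers `|A|` is `τ`. The index `τ` is determined by the formula: each
constructor is one clause of the recursive definition of `|A|`. -/
inductive Formula (K : Ty → Type) : ℕ → Ty → Type
  | atom {n : ℕ} (b : Atomic K n) : Formula K n .state
  | and {n : ℕ} {σ τ : Ty} (A : Formula K n σ) (B : Formula K n τ) : Formula K n (.prod σ τ)
  | or {n : ℕ} {σ τ : Ty} (A : Formula K n σ) (B : Formula K n τ) :
      Formula K n (.prod .bool (.prod σ τ))
  | imp {n : ℕ} {σ τ : Ty} (A : Formula K n σ) (B : Formula K n τ) : Formula K n (σ ⇾ τ)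
  | all {n : ℕ} {τ : Ty} (A : Formula K (n + 1) τ) : Formula K n (.nat ⇾ τ)
  | ex {n : ℕ} {τ : Ty} (A : Formula K (n + 1) τ) : Formula K n (.prod .nat τ)

def Formula.subst : ∀ {n m : ℕ} {τ : Ty}, Formula K n τ → Subst K (nats n) (nats m) → Formula K m τ
  | _, _, _, .atom b, σ => .atom (b.subst σ)
  | _, _, _, .and A B, σ => .and (A.subst σ) (B.subst σ)
  | _, _, _, .or A B, σ => .or (A.subst σ) (B.subst σ)
  | _, _, _, .imp A B, σ => .imp (A.subst σ) (B.subst σ)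
  | n, m, _, .all A, σ => .all (A.subst (n := n + 1) (m := m + 1) σ.lift)
  | n, m, _, .ex A, σ => .ex (A.subst (n := n + 1) (m := m + 1) σ.lift)

/-- `A[t/α]` for the last free variable `α`. -/
def Formula.inst {n : ℕ} {τ : Ty} (A : Formula K (n + 1) τ) (t : Tm K (nats n) .nat) :
    Formula K n τ :=
  A.subst (Subst.inst t)

/-- `A` as a formula with one more variable, which does not occur in it. -/
def Formula.weaken {n : ℕ} {τ : Ty} (A : Formula K n τ) : Formula K (n + 1) τ :=
  A.subst (m := n + 1) (fun _ x => .var (.succ x))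

/-- A closed formula as a formula with `n` variables, which do not occur in it. -/
def Formula.ofClosed {n : ℕ} {τ : Ty} (A : Formula K 0 τ) : Formula K n τ :=
  A.subst (fun _ x => nomatch x)

/-- The closed formula `∀ x₁ ⋯ ∀ xₖ, A`. -/
def Formula.alls : ∀ (k : ℕ) {τ : Ty}, Formula K k τ → Formula K 0 (natArrow k τ)
  | 0, _, A => A
  | k + 1, _, A => Formula.alls k (.all A)

def Formula.size : ∀ {n : ℕ} {τ : Ty}, Formula K n τ → ℕ
  | _, _, .atom _ => 0
  | _, _, .and A B => A.size + B.size + 1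
  | _, _, .or A B => A.size + B.size + 1
  | _, _, .imp A B => A.size + B.size + 1
  | _, _, .all A => A.size + 1
  | _, _, .ex A => A.size + 1

theorem Formula.size_subst {n m : ℕ} {τ : Ty} (A : Formula K n τ) (σ : Subst K (nats n) (nats m)) :
    (A.subst σ).size = A.size := by
  induction A generalizing m with
  | atom b => rfl
  | and A B ihA ihB => simp only [Formula.subst, Formula.size, ihA, ihB]
  | or A B ihA ihB => simp only [Formula.subst, Formula.size, ihA, ihB]
  | imp A B ihA ihB => simp only [Formula.subst, Formula.size, ihA, ihB]
  | @all n τ A ih => exact congrArg (· + 1) (ih (m := m + 1) σ.lift)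
  | @ex n τ A ih => exact congrArg (· + 1) (ih (m := m + 1) σ.lift)

theorem Formula.size_inst {n : ℕ} {τ : Ty} (A : Formula K (n + 1) τ) (t : Tm K (nats n) .nat) :
    (A.inst t).size = A.size :=
  A.size_subst _

/-- Formulas of the language `L_Class` of `HA + EM₁`. -/
abbrev LClass := Formula ClassConst

/-- Formulas of the language `L_Learn`. -/
abbrev LLearn := Formula LearnConst

/-- The approximation `A[s]`. -/
def Formula.approx (s : KState) : ∀ {n : ℕ} {τ : Ty}, LClass n τ → LLearn n τ
  | _, _, .atom b => .atom ⟨b.1.approx s, b.2.replaceConst _⟩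
  | _, _, .and A B => .and (A.approx s) (B.approx s)
  | _, _, .or A B => .or (A.approx s) (B.approx s)
  | _, _, .imp A B => .imp (A.approx s) (B.approx s)
  | _, _, .all A => .all (A.approx s)
  | _, _, .ex A => .ex (A.approx s)

/-! ## The deduction system `HA + EM₁` -/

/-- Boolean expressions in `k` boolean variables. -/
inductive BoolForm (k : ℕ) : Type
  | var (i : Fin k) : BoolForm k
  | true : BoolForm k
  | false : BoolForm k
  | not (φ : BoolForm k) : BoolForm k
  | and (φ ψ : BoolForm k) : BoolForm k
  | or (φ ψ : BoolForm k) : BoolForm k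
  | imp (φ ψ : BoolForm k) : BoolForm k

/-- The boolean term obtained by substituting terms for the variables of a boolean expression. -/
def BoolForm.toTm {k : ℕ} {Γ : Ctx} (p : Fin k → Tm K Γ .bool) : BoolForm k → Tm K Γ .bool
  | .var i => p i
  | .true => .tt
  | .false => .ff
  | .not φ => Tm.bnot (φ.toTm p)
  | .and φ ψ => Tm.band (φ.toTm p) (ψ.toTm p)
  | .or φ ψ => Tm.bor (φ.toTm p) (ψ.toTm p)
  | .imp φ ψ => Tm.bimp (φ.toTm p) (ψ.toTm p)

/-- `ψ` is a tautological consequence of `φ₁, …, φₘ` in `T`: every boolean assignment making all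
`φᵢ` equal to `True` in `T` makes `ψ` equal to `True` in `T`. -/
def TautConsequence {k m : ℕ} (φ : Fin m → BoolForm k) (ψ : BoolForm k) : Prop :=
  ∀ v : Fin k → Bool,
    (∀ i, EqT ((φ i).toTm (fun j => boolTm (v j)) : Tm NoConst [] .bool) .tt) →
      EqT (ψ.toTm (fun j => boolTm (v j)) : Tm NoConst [] .bool) .tt

/-- Terms of `L_Class` with `n` free variables. -/
abbrev LTerm (n : ℕ) := TClass (nats n) .nat

/-- The atomic formula `t = u`. -/
def eqAtom {n : ℕ} (t u : LTerm n) : Atomic ClassConst n := Atomic.mk (m := 2) eqTm ![t, u]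

/-- The atomic formula `t ≤ u`. -/
def leAtom {n : ℕ} (t u : LTerm n) : Atomic ClassConst n := Atomic.mk (m := 2) leTm ![t, u]

/-- The atomic formula `⊥`, that is `False`. -/
def botAtom {n : ℕ} : Atomic ClassConst n := Atomic.mk (m := 0) .ff ![]

/-- The Post rules of `HA + EM₁`, with premises `B₁, …, Bₘ` and conclusion `C`; for `m = 0` these are
the atomic axioms. They comprise the tautological consequences (atomic formulas being read up to
provable equality in `T`, so that, for instance, a boolean combination of atomic formulas is one
atomic formula), the equations of `T`, and the axioms of equality and ordering on `nat`. -/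
inductive PostRule {n : ℕ} : ∀ {m : ℕ}, (Fin m → Atomic ClassConst n) → Atomic ClassConst n → Prop
  | taut {k m : ℕ} (p : Fin k → Atomic ClassConst n) (φ : Fin m → BoolForm k) (ψ : BoolForm k)
      (h : TautConsequence φ ψ) (B : Fin m → Atomic ClassConst n) (C : Atomic ClassConst n)
      (hB : ∀ i, EqT (B i).1 ((φ i).toTm (fun j => (p j).1)))
      (hC : EqT C.1 (ψ.toTm (fun j => (p j).1))) : PostRule B C
  | equation (t u : LTerm n) (h : EqT t u) : PostRule ![] (eqAtom t u)
  | eqSymm (t u : LTerm n) : PostRule ![eqAtom t u] (eqAtom u t)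
  | eqTrans (t u v : LTerm n) : PostRule ![eqAtom t u, eqAtom u v] (eqAtom t v)
  | eqSubst (t u : LTerm n) (C : Atomic ClassConst (n + 1)) :
      PostRule ![eqAtom t u, C.subst (Subst.inst t)] (C.subst (Subst.inst u))
  | sucNeZero (t : LTerm n) : PostRule ![eqAtom (.suc t) .zero] botAtom
  | sucInj (t u : LTerm n) : PostRule ![eqAtom (.suc t) (.suc u)] (eqAtom t u)
  | zeroLe (t : LTerm n) : PostRule ![] (leAtom .zero t)
  | sucLeZero (t : LTerm n) : PostRule ![leAtom (.suc t) .zero] botAtom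
  | sucLeSuc (t u : LTerm n) : PostRule ![leAtom t u] (leAtom (.suc t) (.suc u))
  | leOfSucLeSuc (t u : LTerm n) : PostRule ![leAtom (.suc t) (.suc u)] (leAtom t u)
  | leOfEq (t u : LTerm n) : PostRule ![eqAtom t u] (leAtom t u)
  | leTrans (t u v : LTerm n) : PostRule ![leAtom t u, leAtom u v] (leAtom t v)
  | leAntisymm (t u : LTerm n) : PostRule ![leAtom t u, leAtom u t] (eqAtom t u)
  | leTotal (t u : LTerm n) (C : Atomic ClassConst n)
      (h : EqT C.1 (Tm.bor (leAtom t u).1 (leAtom u t).1)) : PostRule ![] C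

/-- The axiom `∀ x⃗, (∃ y, P(x⃗, y)) ∨ (∀ y, ¬ P(x⃗, y))`, where `¬ P(x⃗, y)` stands for the atomic
formula `(λ x⃗ y, ¬ (P x⃗ y)) x⃗ y`. -/
def em1 {k : ℕ} (P : Pred (k + 1)) :
    LClass 0 (natArrow k (.prod .bool (.prod (.prod .nat .state) (.nat ⇾ .state)))) :=
  Formula.alls k (.or
    (.ex (.atom (Atomic.mk (m := k + 1) P.toTm (natVars (k + 1)))))
    (.all (.atom (Atomic.mk (m := k + 1)
      (lams (k + 1) (Tm.bnot (apps (k + 1) P.toTm (natVars (k + 1))))) (natVars (k + 1))))))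

/-- The realizer `E_P = λ α⃗, ⟨Χ_P α⃗, ⟨Φ_P α⃗, ∅⟩, λ n, Add_P α⃗ n⟩` of the axiom `em1 P`. -/
def em1Tm {k : ℕ} (P : Pred (k + 1)) :
    TClass [] (natArrow k (.prod .bool (.prod (.prod .nat .state) (.nat ⇾ .state)))) :=
  lams k (.pair (apps k (.const (.Chi P)) (natVars k))
    (.pair (.pair (apps k (.const (.Phi P)) (natVars k)) (.const .empty))
      (.lam (apps (k + 1) (Γ := nats (k + 1)) (.const (.Add P)) (natVars (k + 1))))))

/-- The axiom `P(t⃗, t) ⇒ Χ_P t⃗` for the oracles, as the single atomic formula `Q t⃗ t` with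
`Q = λ x⃗ x, (P x⃗ x ⇒ Χ_P x⃗)`. -/
def chiAtom {k n : ℕ} (P : Pred (k + 1)) (ts : Fin k → LTerm n) (t : LTerm n) :
    Atomic ClassConst n :=
  Atomic.mk (m := k + 1)
    (lams (k + 1) (Tm.bimp (apps (k + 1) P.toTm (natVars (k + 1)))
      (apps k (.const (.Chi P)) (fun i => natVars (k + 1) i.castSucc))))
    (Fin.snoc (α := fun _ => LTerm n) ts t)

/-- The axiom `Χ_P t⃗ ⇒ P(t⃗, Φ_P t⃗)` for the Skolem maps, as the single atomic formula `Q t⃗` with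
`Q = λ x⃗, (Χ_P x⃗ ⇒ P x⃗ (Φ_P x⃗))`. -/
def phiAtom {k n : ℕ} (P : Pred (k + 1)) (ts : Fin k → LTerm n) : Atomic ClassConst n :=
  Atomic.mk (m := k)
    (lams k (Tm.bimp (apps k (.const (.Chi P)) (natVars k))
      (.app (apps k (A := .nat ⇾ .bool) P.toTm (natVars k))
        (apps k (.const (.Phi P)) (natVars k)))))
    ts

/-- Finitely many assumptions, labelled by the variables `x` of a context `Δ`: the assumption
labelled by `x : |A|` is the formula `A`. -/
abbrev Assumptions (n : ℕ) (Δ : Ctx) := ∀ ⦃τ : Ty⦄, Var Δ τ → LClass n τ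

def Assumptions.none {n : ℕ} : Assumptions n [] := fun _ x => nomatch x

def Assumptions.cons {n : ℕ} {Δ : Ctx} {σ : Ty} (A : LClass n σ) (G : Assumptions n Δ) :
    Assumptions n (σ :: Δ)
  | _, .zero => A
  | _, .succ x => G x

def Assumptions.weaken {n : ℕ} {Δ : Ctx} (G : Assumptions n Δ) : Assumptions (n + 1) Δ :=
  fun _ x => (G x).weaken

/-- Natural deduction proofs in `HA + EM₁` of a formula with free variables among `n` variables, with
free assumptions among `G`. The conditions on eigenvariables are expressed by weakening. -/
inductive Deriv : ∀ {n : ℕ} {Δ : Ctx} {τ : Ty}, Assumptions n Δ → LClass n τ → Type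
  | ass {n : ℕ} {Δ : Ctx} {G : Assumptions n Δ} {τ : Ty} {A : LClass n τ} (x : Var Δ τ)
      (h : G x = A) : Deriv G A
  | andI {n : ℕ} {Δ : Ctx} {G : Assumptions n Δ} {σ τ : Ty} {A : LClass n σ} {B : LClass n τ}
      (D : Deriv G A) (E : Deriv G B) : Deriv G (.and A B)
  | andE₁ {n : ℕ} {Δ : Ctx} {G : Assumptions n Δ} {σ τ : Ty} {A : LClass n σ} {B : LClass n τ}
      (D : Deriv G (.and A B)) : Deriv G A
  | andE₂ {n : ℕ} {Δ : Ctx} {G : Assumptions n Δ} {σ τ : Ty} {A : LClass n σ} {B : LClass n τ}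
      (D : Deriv G (.and A B)) : Deriv G B
  | impI {n : ℕ} {Δ : Ctx} {G : Assumptions n Δ} {σ τ : Ty} {A : LClass n σ} {B : LClass n τ}
      (D : Deriv (G.cons A) B) : Deriv G (.imp A B)
  | impE {n : ℕ} {Δ : Ctx} {G : Assumptions n Δ} {σ τ : Ty} {A : LClass n σ} {B : LClass n τ}
      (D : Deriv G (.imp A B)) (E : Deriv G A) : Deriv G B
  | orI₁ {n : ℕ} {Δ : Ctx} {G : Assumptions n Δ} {σ τ : Ty} {A : LClass n σ} {B : LClass n τ}
      (D : Deriv G A) : Deriv G (.or A B)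
  | orI₂ {n : ℕ} {Δ : Ctx} {G : Assumptions n Δ} {σ τ : Ty} {A : LClass n σ} {B : LClass n τ}
      (D : Deriv G B) : Deriv G (.or A B)
  | orE {n : ℕ} {Δ : Ctx} {G : Assumptions n Δ} {σ τ υ : Ty} {A : LClass n σ} {B : LClass n τ}
      {C : LClass n υ} (D : Deriv G (.or A B)) (E₁ : Deriv (G.cons A) C)
      (E₂ : Deriv (G.cons B) C) : Deriv G C
  | allI {n : ℕ} {Δ : Ctx} {G : Assumptions n Δ} {τ : Ty} {A : LClass (n + 1) τ}
      (D : Deriv G.weaken A) : Deriv G (.all A)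
  | allE {n : ℕ} {Δ : Ctx} {G : Assumptions n Δ} {τ : Ty} {A : LClass (n + 1) τ}
      (D : Deriv G (.all A)) (t : LTerm n) : Deriv G (A.inst t)
  | exI {n : ℕ} {Δ : Ctx} {G : Assumptions n Δ} {τ : Ty} {A : LClass (n + 1) τ}
      (t : LTerm n) (D : Deriv G (A.inst t)) : Deriv G (.ex A)
  | exE {n : ℕ} {Δ : Ctx} {G : Assumptions n Δ} {σ τ : Ty} {A : LClass (n + 1) σ} {C : LClass n τ}
      (D : Deriv G (.ex A)) (E : Deriv (G.weaken.cons A) C.weaken) : Deriv G C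
  | ind {n : ℕ} {Δ : Ctx} {G : Assumptions n Δ} {τ : Ty} {A : LClass (n + 1) τ}
      (D : Deriv G (A.inst .zero))
      (E : Deriv G (.all (.imp A (A.subst (m := n + 1) Subst.sucLast)))) : Deriv G (.all A)
  | post {n : ℕ} {Δ : Ctx} {G : Assumptions n Δ} {m : ℕ} {B : Fin m → Atomic ClassConst n}
      {C : Atomic ClassConst n} (h : PostRule B C) (D : ∀ i, Deriv G (.atom (B i))) :
      Deriv G (.atom C)
  | em1 {n : ℕ} {Δ : Ctx} {G : Assumptions n Δ} {k : ℕ} (P : Pred (k + 1)) :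
      Deriv G (em1 P).ofClosed
  | chi {n : ℕ} {Δ : Ctx} {G : Assumptions n Δ} {k : ℕ} (P : Pred (k + 1)) (ts : Fin k → LTerm n)
      (t : LTerm n) : Deriv G (.atom (chiAtom P ts t))
  | phi {n : ℕ} {Δ : Ctx} {G : Assumptions n Δ} {k : ℕ} (P : Pred (k + 1)) (ts : Fin k → LTerm n) :
      Deriv G (.atom (phiAtom P ts))

/-- A closed formula is provable in `HA + EM₁` if it has a proof without free assumptions (in which
further free variables may occur). -/
def Provable {τ : Ty} (A : LClass 0 τ) : Prop :=
  ∃ n : ℕ, Nonempty (Deriv (n := n) Assumptions.none A.ofClosed)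

/-! ## Decoration of proofs with realizers -/

/-- The dummy term of type `A`. -/
def dummy : ∀ {Γ : Ctx} (A : Ty), TClass Γ A
  | _, .nat => .zero
  | _, .bool => .ff
  | _, .state => .const .empty
  | _, .prod A B => .pair (dummy A) (dummy B)
  | _, .arrow _ B => .lam (dummy B)

/-- `u₁ ∪ ⋯ ∪ uₘ` (associated to the left), which is `∅` for `m = 0`. -/
def cups {Γ : Ctx} : ∀ {m : ℕ}, (Fin m → TClass Γ .state) → TClass Γ .state
  | 0, _ => .const .empty
  | 1, u => u 0
  | m + 2, u => .app (.app (.const .cup) (cups (m := m + 1) (fun i => u i.castSucc)))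
      (u (Fin.last (m + 1)))

/-- The term decorating the conclusion of a proof, in a context `Ξ` in which `ρ` names the free
assumptions and `ν` names the free variables of type `nat`. -/
def Deriv.decorate : ∀ {n : ℕ} {Δ : Ctx} {τ : Ty} {G : Assumptions n Δ} {A : LClass n τ},
    Deriv G A → ∀ {Ξ : Ctx}, Ren Δ Ξ → Ren (nats n) Ξ → TClass Ξ τ
  | _, _, _, _, _, .ass x _, _, ρ, _ => .var (ρ x)
  | _, _, _, _, _, .andI D E, _, ρ, ν => .pair (D.decorate ρ ν) (E.decorate ρ ν)
  | _, _, _, _, _, .andE₁ D, _, ρ, ν => .fst (D.decorate ρ ν)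
  | _, _, _, _, _, .andE₂ D, _, ρ, ν => .snd (D.decorate ρ ν)
  | _, _, _, _, _, .impI D, _, ρ, ν => .lam (D.decorate ρ.lift ν.wk)
  | _, _, _, _, _, .impE D E, _, ρ, ν => .app (D.decorate ρ ν) (E.decorate ρ ν)
  | _, _, _, _, _, .orI₁ D, _, ρ, ν => .pair .tt (.pair (D.decorate ρ ν) (dummy _))
  | _, _, _, _, _, .orI₂ D, _, ρ, ν => .pair .ff (.pair (dummy _) (D.decorate ρ ν))
  | _, _, _, _, _, .orE D E₁ E₂, _, ρ, ν =>
      Tm.cond (Tm.p0 (D.decorate ρ ν))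
        (.app (.lam (E₁.decorate ρ.lift ν.wk)) (Tm.p1 (D.decorate ρ ν)))
        (.app (.lam (E₂.decorate ρ.lift ν.wk)) (Tm.p2 (D.decorate ρ ν)))
  | _, _, _, _, _, .allI D, _, ρ, ν => .lam (D.decorate ρ.wk ν.lift)
  | _, _, _, _, _, .allE D t, _, ρ, ν => .app (D.decorate ρ ν) (t.rename ν)
  | _, _, _, _, _, .exI t D, _, ρ, ν => .pair (t.rename ν) (D.decorate ρ ν)
  | _, _, _, _, _, .exE D E, _, ρ, ν =>
      .app (.app (.lam (.lam (E.decorate ρ.wk.lift (Ren.wk ν.lift)))) (.fst (D.decorate ρ ν)))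
        (.snd (D.decorate ρ ν))
  | _, _, _, _, _, .ind D E, _, ρ, ν =>
      .lam (.app (.app (.app (.recN _) (D.decorate ρ.wk ν.wk)) (E.decorate ρ.wk ν.wk))
        (.var .zero))
  | _, _, _, _, _, .post _ D, _, ρ, ν => cups (fun i => (D i).decorate ρ ν)
  | _, _, _, _, _, .em1 P, _, _, _ => (em1Tm P).ofClosed
  | _, _, _, _, _, .chi (k := k) P ts t, _, _, ν =>
      .app (apps k (A := .nat ⇾ .state) (.const (.Add P)) (fun i => (ts i).rename ν)) (t.rename ν)
  | _, _, _, _, _, .phi _ _, _, _, _ => .const .empty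

/-- The term `D*`, whose free variables are the labels of the assumptions and the free variables of
type `nat` of the proof. -/
def Deriv.star {n : ℕ} {Δ : Ctx} {τ : Ty} {G : Assumptions n Δ} {A : LClass n τ} (D : Deriv G A) :
    TClass (Δ ++ nats n) τ :=
  D.decorate Ren.inl Ren.inr

/-! ## Realizability -/

/-- Indexed realizability `t ⊩ₛ A` for closed terms `t` of `T_Learn` and closed formulas `A` of
`L_Learn`. In the clause for implication, `u` ranges over the terms `u'[s]` with `u'` a closed term of
`T_Class` of state `∅`. -/
def Realizes (s : KState) : ∀ {τ : Ty}, TLearn [] τ → LLearn 0 τ → Prop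
  | _, t, .atom b => EqLearn t (stTm KState.empty) → EqLearn b.1 .tt
  | _, t, .and A B => Realizes s (.fst t) A ∧ Realizes s (.snd t) B
  | _, t, .or A B => (EqLearn (Tm.p0 t) .tt ∧ Realizes s (Tm.p1 t) A) ∨
      (EqLearn (Tm.p0 t) .ff ∧ Realizes s (Tm.p2 t) B)
  | _, t, .imp A B =>
      ∀ u : TClass [] _, Realizes s (u.approx s) A → Realizes s (.app t (u.approx s)) B
  | _, t, .all A => ∀ n : ℕ, Realizes s (.app t (num n)) (A.inst (num n))
  | _, t, .ex A => ∃ n : ℕ, EqLearn (.fst t) (num n) ∧ Realizes s (.snd t) (A.inst (num n))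
termination_by _ _ A => A.size
decreasing_by all_goals simp only [Formula.size, Formula.size_inst]; omega

/-- Indexed realizability `t ⊪ₛ A` for closed terms `t` of `T_Class` of state `∅` and closed formulas
`A` of `L_Class`. -/
def ClassRealizesAt (s : KState) : ∀ {τ : Ty}, TClass [] τ → LClass 0 τ → Prop
  | _, t, .atom b => EqLearn (t.approx s) (stTm KState.empty) → EqLearn (b.1.approx s) .tt
  | _, t, .and A B => ClassRealizesAt s (.fst t) A ∧ ClassRealizesAt s (.snd t) B
  | _, t, .or A B => (EqLearn ((Tm.p0 t).approx s) .tt ∧ ClassRealizesAt s (Tm.p1 t) A) ∨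
      (EqLearn ((Tm.p0 t).approx s) .ff ∧ ClassRealizesAt s (Tm.p2 t) B)
  | _, t, .imp A B =>
      ∀ u : TClass [] _, ClassRealizesAt s u A → ClassRealizesAt s (.app t u) B
  | _, t, .all A => ∀ n : ℕ, ClassRealizesAt s (.app t (num n)) (A.inst (num n))
  | _, t, .ex A => ∃ n : ℕ, EqLearn ((Tm.fst t).approx s) (num n) ∧
      ClassRealizesAt s (.snd t) (A.inst (num n))
termination_by _ _ A => A.size
decreasing_by all_goals simp only [Formula.size, Formula.size_inst]; omega

/-- Learning-based realizability `t ⊪ A`. -/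
def ClassRealizes {τ : Ty} (t : TClass [] τ) (A : LClass 0 τ) : Prop :=
  ∀ s : KState, ClassRealizesAt s t A

end HAEM1

open HAEM1

namespace HAEM1
variable {K K' : Ty → Type}

/-! ## Composition of substitutions -/

/-! All notions are moved from provable equality to the full set-theoretic model, in which `nat`
denotes ℕ, `bool` denotes `Bool` and `state` denotes the set of states of knowledge. Provable
equality is sound there (`Conv.eval_eq`). Conversely, a logical relation between closed terms and
elements of the model (`Computes.subst_eval`) shows that a closed term of type `nat`, `bool` or
`state` of $T_{Learn}$ is provably equal to the canonical term of its value. The equations occurring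
in realizability all have this kind, so they become statements about values (`eqLearn_num_iff`,
`eqLearn_boolTm_iff`, `eqLearn_stTm_iff`).

Approximation at `s` only reinterprets constants (`Tm.eval_approx`). Hence both realizability
relations translate to one relation `LClass.Sat` in the model, where the realizers of a premise
range over the elements definable at `s` by closed terms of $T_{Class}$ (`realizes_iff_sat`,
`Formula.sat_approx`, `classRealizesAt_iff_sat`).

Adequacy is then an induction on proofs in the model (`Deriv.sat_decorate`). The classical content
rests on two facts. A state stores only true atoms, so what it knows is correct
(`KState.val_witness`). A counterexample to an oracle's negative answer makes `Add` return a
nonempty state, so the empty state certifies that there is none at that argument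
(`KState.knows_of_added_eq_empty`). Unions propagate this through Post rules, since a consistent
union is empty only if both parts are (`KState.cup_eq_empty`). -/

theorem Subst.lift_rename {Γ Δ Θ : Ctx} {B : Ty} (σ : Subst K Γ Δ) (ρ : Ren Δ Θ) :
    (fun _ x => (σ.lift x).rename ρ.lift : Subst K (B :: Γ) (B :: Θ)) =
      Subst.lift (fun _ x => (σ x).rename ρ) := by
  funext A x
  cases x with
  | zero => rfl
  | succ x => simp only [Subst.lift, Tm.rename_rename]; rfl

theorem Tm.rename_subst {Γ Δ Θ : Ctx} {A : Ty} (t : Tm K Γ A) (σ : Subst K Γ Δ) (ρ : Ren Δ Θ) :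
    (t.subst σ).rename ρ = t.subst (fun _ x => (σ x).rename ρ) := by
  induction t generalizing Δ Θ <;> simp_all only [Tm.rename, Tm.subst, Subst.lift_rename]

theorem Subst.lift_subst {Γ Δ Θ : Ctx} {B : Ty} (σ : Subst K Γ Δ) (τ : Subst K Δ Θ) :
    (fun _ x => (σ.lift x).subst τ.lift : Subst K (B :: Γ) (B :: Θ)) =
      Subst.lift (fun _ x => (σ x).subst τ) := by
  funext A x
  cases x with
  | zero => rfl
  | succ x => simp only [Subst.lift, Tm.subst_rename, Tm.rename_subst]

theorem Tm.subst_subst {Γ Δ Θ : Ctx} {A : Ty} (t : Tm K Γ A) (σ : Subst K Γ Δ) (τ : Subst K Δ Θ) :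
    (t.subst σ).subst τ = t.subst (fun _ x => (σ x).subst τ) := by
  induction t generalizing Δ Θ <;> simp_all only [Tm.subst, Subst.lift_subst]

theorem Tm.rename_eq_self {Γ : Ctx} {A : Ty} (t : Tm K Γ A) : t.rename (fun _ x => x) = t := by
  have lift_id : ∀ {Γ : Ctx} {B : Ty}, (Ren.lift (fun _ x => x) : Ren (B :: Γ) (B :: Γ)) =
      fun _ x => x := by
    intro Γ B
    funext A x
    cases x <;> rfl
  induction t <;> simp_all only [Tm.rename]

theorem Tm.subst_eq_self {Γ : Ctx} {A : Ty} (t : Tm K Γ A) : t.subst (fun _ x => .var x) = t := by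
  rw [Tm.subst_var t (fun _ x => x), Tm.rename_eq_self]

def Subst.cons {Γ Δ : Ctx} {B : Ty} (u : Tm K Δ B) (σ : Subst K Γ Δ) : Subst K (B :: Γ) Δ
  | _, .zero => u
  | _, .succ x => σ x

/-- After a β-step under a closing substitution, a single simultaneous substitution remains. The
induction hypothesis for the body of an abstraction applies only in that form. -/
theorem Tm.subst_lift_inst {Γ Δ : Ctx} {A B : Ty} (t : Tm K (B :: Γ) A) (σ : Subst K Γ Δ)
    (u : Tm K Δ B) : (t.subst σ.lift).subst (Subst.inst u) = t.subst (Subst.cons u σ) := by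
  rw [Tm.subst_subst]
  congr 1
  funext A x
  cases x with
  | zero => rfl
  | succ x => simp only [Subst.lift, Subst.cons, Tm.subst_rename]; exact Tm.subst_eq_self _

/-! ## The full set-theoretic model -/

/-- The set denoted by a type. -/
@[reducible] def Ty.den : Ty → Type
  | .nat => ℕ
  | .bool => Bool
  | .state => KState
  | .prod A B => A.den × B.den
  | .arrow A B => A.den → B.den

/-- Valuations of the variables of a context. -/
abbrev Env (Γ : Ctx) := ∀ ⦃A : Ty⦄, Var Γ A → A.den

def Env.nil : Env [] := fun _ x => nomatch x

def Env.cons {Γ : Ctx} {B : Ty} (b : B.den) (ε : Env Γ) : Env (B :: Γ)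
  | _, .zero => b
  | _, .succ x => ε x

theorem Env.eq_nil (ε : Env []) : ε = Env.nil := funext fun _ => funext fun x => nomatch x

/-- Interpretations of a family of constants. -/
abbrev Interp (K : Ty → Type) := ∀ ⦃A : Ty⦄, K A → A.den

/-- The value of a term in the model. -/
def Tm.eval (I : Interp K) : ∀ {Γ : Ctx} {A : Ty}, Tm K Γ A → Env Γ → A.den
  | _, _, .var x, ε => ε x
  | _, _, .const c, _ => I c
  | _, _, .zero, _ => (0 : ℕ)
  | _, _, .suc t, ε => Nat.succ (t.eval I ε)
  | _, _, .tt, _ => true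
  | _, _, .ff, _ => false
  | _, _, .ite _, _ => fun b x y => _root_.cond b x y
  | _, _, .recN _, _ => fun x f n => Nat.rec x f n
  | _, _, .app t u, ε => t.eval I ε (u.eval I ε)
  | _, _, .lam t, ε => fun b => t.eval I (Env.cons b ε)
  | _, _, .pair t u, ε => (t.eval I ε, u.eval I ε)
  | _, _, .fst t, ε => (t.eval I ε).1
  | _, _, .snd t, ε => (t.eval I ε).2

theorem Tm.eval_app (I : Interp K) {Γ : Ctx} {A B : Ty} (t : Tm K Γ (A ⇾ B)) (u : Tm K Γ A)
    (ε : Env Γ) : (Tm.app t u).eval I ε = t.eval I ε (u.eval I ε) := rfl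

theorem Env.cons_lift {Γ Δ : Ctx} {B : Ty} (b : B.den) (ρ : Ren Γ Δ) (ε : Env Δ) :
    (fun _ x => Env.cons b ε (ρ.lift x) : Env (B :: Γ)) = Env.cons b (fun _ x => ε (ρ x)) := by
  funext A x
  cases x <;> rfl

theorem Tm.eval_rename (I : Interp K) {Γ Δ : Ctx} {A : Ty} (t : Tm K Γ A) (ρ : Ren Γ Δ)
    (ε : Env Δ) : (t.rename ρ).eval I ε = t.eval I (fun _ x => ε (ρ x)) := by
  induction t generalizing Δ <;> simp_all only [Tm.rename, Tm.eval, Env.cons_lift]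

theorem Tm.eval_ofClosed (I : Interp K) {Γ : Ctx} {A : Ty} (t : Tm K [] A) (ε : Env Γ) :
    t.ofClosed.eval I ε = t.eval I Env.nil := by
  rw [Tm.ofClosed, Tm.eval_rename, Env.eq_nil (fun _ _ => _)]

theorem Env.cons_subst_lift (I : Interp K) {Γ Δ : Ctx} {B : Ty} (b : B.den) (σ : Subst K Γ Δ)
    (ε : Env Δ) : (fun _ x => (σ.lift x).eval I (Env.cons b ε) : Env (B :: Γ)) =
      Env.cons b (fun _ x => (σ x).eval I ε) := by
  funext A x
  cases x with
  | zero => rfl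
  | succ x => simp only [Subst.lift, Tm.eval_rename]; rfl

theorem Tm.eval_subst (I : Interp K) {Γ Δ : Ctx} {A : Ty} (t : Tm K Γ A) (σ : Subst K Γ Δ)
    (ε : Env Δ) : (t.subst σ).eval I ε = t.eval I (fun _ x => (σ x).eval I ε) := by
  induction t generalizing Δ <;> simp_all only [Tm.subst, Tm.eval, Env.cons_subst_lift]

theorem Env.inst (I : Interp K) {Γ : Ctx} {B : Ty} (u : Tm K Γ B) (ε : Env Γ) :
    (fun _ x => (Subst.inst u x).eval I ε : Env (B :: Γ)) = Env.cons (u.eval I ε) ε := by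
  funext A x
  cases x <;> rfl

/-- Replacing constants by closed terms amounts to changing the interpretation. This is what later
lets $t[s]$ and $t$ be compared in one model. -/
theorem Tm.eval_replaceConst (f : ∀ ⦃A : Ty⦄, K A → Tm K' [] A) (I : Interp K') {Γ : Ctx} {A : Ty}
    (t : Tm K Γ A) (ε : Env Γ) :
    (t.replaceConst f).eval I ε = t.eval (fun _ c => (f c).eval I Env.nil) ε := by
  induction t <;> simp_all only [Tm.replaceConst, Tm.eval, Tm.eval_ofClosed]

@[simp] theorem eval_num (I : Interp K) {Γ : Ctx} (n : ℕ) (ε : Env Γ) :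
    (num n : Tm K Γ .nat).eval I ε = n := by
  induction n with
  | zero => rfl
  | succ n ih => simp only [num, Tm.eval, ih]

@[simp] theorem eval_boolTm (I : Interp K) {Γ : Ctx} (b : Bool) (ε : Env Γ) :
    (boolTm b : Tm K Γ .bool).eval I ε = b := by
  cases b <;> rfl

theorem Contract.eval_eq (I : Interp K) {Γ : Ctx} {A : Ty} {t u : Tm K Γ A} (h : Contract t u)
    (ε : Env Γ) : t.eval I ε = u.eval I ε := by
  cases h with
  | beta => simp only [Tm.eval, Tm.eval_subst, Env.inst]
  | _ => rfl

/-- Soundness of the equational theory. -/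
theorem Conv.eval_eq {R : ∀ ⦃Γ : Ctx⦄ ⦃A : Ty⦄, Tm K Γ A → Tm K Γ A → Prop} (I : Interp K)
    (hR : ∀ ⦃Γ : Ctx⦄ ⦃A : Ty⦄ (t u : Tm K Γ A), R t u → ∀ ε, t.eval I ε = u.eval I ε)
    {Γ : Ctx} {A : Ty} {t u : Tm K Γ A} (h : Conv R t u) (ε : Env Γ) :
    t.eval I ε = u.eval I ε := by
  induction h with
  | refl => rfl
  | symm _ ih => exact (ih ε).symm
  | trans _ _ ih₁ ih₂ => exact (ih₁ ε).trans (ih₂ ε)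
  | contract h => exact h.eval_eq I ε
  | rule h => exact hR _ _ h ε
  | lam _ ih => exact funext fun b => ih (Env.cons b ε)
  | _ => simp_all only [Tm.eval]

theorem EqT.eval_eq (I : Interp K) {Γ : Ctx} {A : Ty} {t u : Tm K Γ A} (h : EqT t u)
    (ε : Env Γ) : t.eval I ε = u.eval I ε :=
  Conv.eval_eq I (fun _ _ _ _ h => h.elim) h ε

/-! ## Functions of several numerical arguments -/

/-- `natArrow` puts a new argument at the end, so the recursion turns the result type `A` into `nat
⇾ A` and splits off the last coordinate of the vector. -/
def napp : ∀ (k : ℕ) {A : Ty}, (natArrow k A).den → (Fin k → ℕ) → A.den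
  | 0, _, f, _ => f
  | k + 1, A, f, v => napp k (A := .nat ⇾ A) f (fun i => v i.castSucc) (v (Fin.last k))

def ncurry : ∀ (k : ℕ) {A : Ty}, ((Fin k → ℕ) → A.den) → (natArrow k A).den
  | 0, _, f => f Fin.elim0
  | k + 1, A, f => ncurry k (A := .nat ⇾ A) (fun v x => f (Fin.snoc (α := fun _ => ℕ) v x))

@[simp] theorem napp_ncurry : ∀ (k : ℕ) {A : Ty} (f : (Fin k → ℕ) → A.den) (v : Fin k → ℕ),
    napp k (ncurry k f) v = f v
  | 0, _, f, v => congrArg f (Subsingleton.elim _ _)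
  | k + 1, A, f, v => by
    rw [napp, ncurry, napp_ncurry k (A := .nat ⇾ A)]
    exact congrArg f (Fin.snoc_init_self (α := fun _ => ℕ) v)

theorem eval_apps (I : Interp K) {Γ : Ctx} (ε : Env Γ) : ∀ (k : ℕ) {A : Ty}
    (t : Tm K Γ (natArrow k A)) (ts : Fin k → Tm K Γ .nat),
    (apps k t ts).eval I ε = napp k (t.eval I ε) (fun i => (ts i).eval I ε)
  | 0, _, _, _ => rfl
  | k + 1, A, t, ts => by
    simp only [apps, napp, Tm.eval]
    rw [eval_apps I ε k (A := .nat ⇾ A)]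

/-- The valuation of the variables `x₁, …, xₖ` by the components of a vector. -/
def natsEnv : ∀ {k : ℕ}, (Fin k → ℕ) → Env (nats k)
  | k + 1, v, _, .zero => v (Fin.last k)
  | _ + 1, v, _, .succ x => natsEnv (fun i => v i.castSucc) x

/-- The innermost variable takes the last coordinate, in agreement with the order in which `lams`
binds; in `numSub` it takes the first one. -/
theorem natsEnv_succ {k : ℕ} (v : Fin (k + 1) → ℕ) :
    natsEnv v = Env.cons (B := .nat) (v (Fin.last k)) (natsEnv (fun i => v i.castSucc)) := by
  funext A x
  cases x <;> rfl

theorem natsEnv_snoc {k : ℕ} (v : Fin k → ℕ) (m : ℕ) :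
    natsEnv (Fin.snoc (α := fun _ => ℕ) v m) = Env.cons (B := .nat) m (natsEnv v) := by
  simp only [natsEnv_succ, Fin.snoc_last, Fin.snoc_castSucc]

theorem eval_natVars (I : Interp K) : ∀ {k : ℕ} (v : Fin k → ℕ) (i : Fin k),
    (natVars k i : Tm K (nats k) .nat).eval I (natsEnv v) = v i
  | k + 1, v, i => by
    refine Fin.lastCases ?_ (fun i => ?_) i
    · simp only [natVars, Fin.snoc_last]; rfl
    · simp only [natVars, Fin.snoc_castSucc, Tm.eval_rename]
      exact eval_natVars I (fun i => v i.castSucc) i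

theorem napp_eval_lams (I : Interp K) : ∀ (k : ℕ) {A : Ty} (t : Tm K (nats k) A) (v : Fin k → ℕ),
    napp k ((lams k t).eval I Env.nil) v = t.eval I (natsEnv v)
  | 0, _, t, v => congrArg (t.eval I) (Env.eq_nil _).symm
  | k + 1, A, t, v => by
    rw [lams, napp, napp_eval_lams I k (A := .nat ⇾ A), natsEnv_succ]
    rfl

/-! ## Closed terms of ground type -/

section Computability

-- The clause at type `state` is left as a parameter `Q`: pure system `T` has no canonical terms of
-- that type, while in $T_{Learn}$ the clause will be provable equality to a state constant.
variable (R : ∀ ⦃Γ : Ctx⦄ ⦃A : Ty⦄, Tm K Γ A → Tm K Γ A → Prop)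
  (Q : Tm K [] .state → KState → Prop)

/-- The logical relation between closed terms and elements of the model which, at the ground types
`nat` and `bool`, is provable equality to the canonical term denoting the element. -/
def Computes : ∀ {A : Ty}, Tm K [] A → A.den → Prop
  | .nat, t, n => Conv R t (num n)
  | .bool, t, b => Conv R t (boolTm b)
  | .state, t, S => Q t S
  | .prod A B, t, p => Computes (A := A) (.fst t) p.1 ∧ Computes (A := B) (.snd t) p.2
  | .arrow A B, t, f => ∀ (u : Tm K [] A) (a : A.den), Computes u a →
      Computes (A := B) (.app t u) (f a)

variable {R Q} (hQ : ∀ t u S, Conv R t u → Q u S → Q t S)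
include hQ

/-- The relation is closed under conversion of the term, so in the fundamental lemma every redex may
be contracted before it is analysed. -/
theorem Computes.of_conv : ∀ {A : Ty} {t u : Tm K [] A} {a : A.den}, Conv R t u →
    Computes R Q u a → Computes R Q t a
  | .nat, _, _, _, h, hu => h.trans hu
  | .bool, _, _, _, h, hu => h.trans hu
  | .state, _, _, _, h, hu => hQ _ _ _ h hu
  | .prod _ _, _, _, _, h, hu => ⟨Computes.of_conv h.fst hu.1, Computes.of_conv h.snd hu.2⟩
  | .arrow _ _, _, _, _, h, hu => fun w a hw => Computes.of_conv (h.app (.refl w)) (hu w a hw)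

/-- The fundamental lemma of the logical relation. -/
theorem Computes.subst_eval {I : Interp K}
    (hI : ∀ ⦃A : Ty⦄ (c : K A), Computes R Q (.const c) (I c)) {Γ : Ctx} {A : Ty} (t : Tm K Γ A)
    (σ : Subst K Γ []) (ε : Env Γ) (h : ∀ ⦃A : Ty⦄ (x : Var Γ A), Computes R Q (σ x) (ε x)) :
    Computes R Q (t.subst σ) (t.eval I ε) := by
  induction t with
  | var x => exact h x
  | const c => exact hI c
  | zero => exact Conv.refl _
  | suc t ih => exact Conv.suc (ih σ ε h)
  | tt => exact Conv.refl _
  | ff => exact Conv.refl _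
  | ite A =>
    intro b b' hb u a hu v a' hv
    refine Computes.of_conv hQ (((Conv.refl _).app hb).app (.refl u) |>.app (.refl v)) ?_
    cases b' with
    | true => exact Computes.of_conv hQ (.contract (.iteTrue u v)) hu
    | false => exact Computes.of_conv hQ (.contract (.iteFalse u v)) hv
  | recN A =>
    intro u a hu v f hv w n hw
    -- The argument is replaced by the numeral of its value; the recursor is then handled by
    -- induction on that value.
    refine Computes.of_conv hQ ((Conv.refl _).app hw) ?_
    clear hw
    induction n with
    | zero => exact Computes.of_conv hQ (.contract (.recZero u v)) hu
    | succ n ih =>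
      exact Computes.of_conv hQ (.contract (.recSuc u v (num n)))
        (hv _ _ (Conv.refl (num n)) _ _ ih)
  | app t u iht ihu => exact iht σ ε h _ _ (ihu σ ε h)
  | lam t ih =>
    intro u a hu
    refine Computes.of_conv hQ (.contract (.beta _ u)) ?_
    rw [Tm.subst_lift_inst]
    refine ih _ _ ?_
    intro B x
    cases x with
    | zero => exact hu
    | succ x => exact h x
  | pair t u iht ihu =>
    exact ⟨Computes.of_conv hQ (.contract (.fst _ _)) (iht σ ε h),
      Computes.of_conv hQ (.contract (.snd _ _)) (ihu σ ε h)⟩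
  | fst t ih => exact (ih σ ε h).1
  | snd t ih => exact (ih σ ε h).2

theorem Computes.eval {I : Interp K}
    (hI : ∀ ⦃A : Ty⦄ (c : K A), Computes R Q (.const c) (I c)) {A : Ty} (t : Tm K [] A) :
    Computes R Q t (t.eval I Env.nil) := by
  have := Computes.subst_eval hQ hI t (fun _ x => .var x) Env.nil (fun _ x => nomatch x)
  rwa [Tm.subst_eq_self] at this

/-- A related argument of type `nat` is convertible to a numeral, so a function of numbers need only
be tested on numerals. The rules for `chi`, `phi` and `add` speak of nothing else. -/
theorem Computes.ncurry : ∀ (k : ℕ) {A : Ty} (t : Tm K [] (natArrow k A))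
    (f : (Fin k → ℕ) → A.den), (∀ v, Computes R Q (apps k t (fun i => num (v i))) (f v)) →
    Computes R Q t (ncurry k f)
  | 0, _, _, _, h => h _
  | k + 1, A, t, f, h => by
    refine Computes.ncurry k (A := .nat ⇾ A) t _ fun v u a hu => ?_
    refine Computes.of_conv hQ ((Conv.refl _).app hu) ?_
    have := h (Fin.snoc (α := fun _ => ℕ) v a)
    simpa only [apps, Fin.snoc_castSucc, Fin.snoc_last] using this

end Computability

/-! ### System `T` -/

def noInterp : Interp NoConst := fun _ c => nomatch c

/-- With no constants the hypothesis on constants is vacuous, and `Q` may be taken empty.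
Consequently each closed boolean term of `T` equals exactly one of `tt` and `ff`. -/
theorem EqT.boolTm_eval (t : Tm NoConst [] .bool) : EqT t (boolTm (t.eval noInterp Env.nil)) :=
  Computes.eval (Q := fun _ _ => False) (A := .bool) (fun _ _ _ _ h => h) (fun _ c => nomatch c) t

theorem eqT_tt_iff {t : Tm NoConst [] .bool} : EqT t .tt ↔ t.eval noInterp Env.nil = true := by
  refine ⟨fun h => EqT.eval_eq noInterp h _, fun h => ?_⟩
  have := EqT.boolTm_eval t
  rwa [h] at this

theorem eqT_ff_iff {t : Tm NoConst [] .bool} : EqT t .ff ↔ t.eval noInterp Env.nil = false := by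
  refine ⟨fun h => EqT.eval_eq noInterp h _, fun h => ?_⟩
  have := EqT.boolTm_eval t
  rwa [h] at this

/-- The truth value of a predicate of `T`. -/
def Pred.val {k : ℕ} (P : Pred k) (v : Fin k → ℕ) : Bool := napp k (P.tm.eval noInterp Env.nil) v

theorem Pred.eval_at {k : ℕ} (P : Pred (k + 1)) (v : Fin k → ℕ) (m : ℕ) :
    (P.at v m).eval noInterp Env.nil = P.val (Fin.snoc (α := fun _ => ℕ) v m) := by
  simp only [Pred.at, Tm.eval, Pred.val, napp, Fin.snoc_castSucc, Fin.snoc_last, eval_num]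
  rw [eval_apps _ _ k (A := .nat ⇾ .bool)]
  simp only [eval_num]

theorem Pred.eval_toTm {k : ℕ} {Γ : Ctx} (P : Pred k) (I : Interp K) (ε : Env Γ) :
    P.toTm.eval I ε = P.tm.eval noInterp Env.nil := by
  rw [Pred.toTm, Tm.eval_ofClosed, Tm.eval_replaceConst]
  congr 1
  funext A c
  exact nomatch c

theorem EMAtom.val_eq_true (a : EMAtom) : a.P.val (Fin.snoc (α := fun _ => ℕ) a.n a.m) = true := by
  rw [← Pred.eval_at]
  exact eqT_tt_iff.1 a.holds

/-! ### The system `T_Learn` -/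

open Classical in
/-- The witness which a state knows for the given predicate and arguments, or `0`. -/
noncomputable def KState.witness (S : KState) (κ : Key) : ℕ :=
  if h : S.Knows κ then h.choose.m else 0

open Classical in
/-- The state of at most one atom added by `add`. -/
noncomputable def KState.added (S : KState) {k : ℕ} (P : Pred (k + 1)) (v : Fin k → ℕ) (m : ℕ) :
    KState :=
  if h : ¬ S.Knows ⟨k, P, v⟩ ∧ EqT (P.at v m) .tt then KState.single ⟨k, P, v, m, h.2⟩
  else KState.empty

/-- Consistency of the state makes the choice in `witness` immaterial: all its atoms with a given
key carry the same number. -/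
theorem KState.witness_key (S : KState) (a : EMAtom) (h : a ∈ S.atoms) :
    S.witness a.key = a.m := by
  have hk : S.Knows a.key := ⟨a, h, rfl⟩
  rw [KState.witness, dif_pos hk]
  exact S.consistent _ hk.choose_spec.1 a h hk.choose_spec.2

theorem KState.single_ne_empty (a : EMAtom) : KState.single a ≠ KState.empty := fun h =>
  (congrArg (fun S => a ∈ S.atoms) h).mp rfl

theorem KState.ext_atoms {S T : KState} (h : S.atoms = T.atoms) : S = T := by
  cases S; cases T; cases h; rfl

/-- All atoms of `S` survive in the union, so `S` is empty; then nothing in `S` can conflict with an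
atom of `T`, and all atoms of `T` survive as well. -/
theorem KState.cup_eq_empty {S T : KState} (h : S.cup T = KState.empty) :
    S = KState.empty ∧ T = KState.empty := by
  have h' : (S.cup T).atoms = ∅ := congrArg KState.atoms h
  have hS : S.atoms = ∅ := Set.eq_empty_of_forall_notMem fun a ha =>
    Set.notMem_empty a (h' ▸ Or.inl ha)
  refine ⟨KState.ext_atoms hS, KState.ext_atoms (Set.eq_empty_of_forall_notMem fun a ha =>
    Set.notMem_empty a (h' ▸ Or.inr ⟨ha, fun b hb => ?_⟩))⟩
  rw [hS] at hb
  exact hb.elim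

open Classical in
noncomputable def learnInterp : Interp LearnConst
  | _, .st S => S
  | _, .cup => KState.cup
  | _, .chi (k := k) P => fun S => ncurry k fun v => decide (S.Knows ⟨k, P, v⟩)
  | _, .phi (k := k) P => fun S => ncurry k fun v => S.witness ⟨k, P, v⟩
  | _, .add (k := k) P => fun S => ncurry (k + 1) fun v =>
      S.added P (fun i => v i.castSucc) (v (Fin.last k))

theorem learnInterp_add {k : ℕ} (P : Pred (k + 1)) (S : KState) :
    (learnInterp (.add P) S : (natArrow (k + 1) .state).den) = ncurry (k + 1) (A := .state) fun v =>
      S.added P (fun i => v i.castSucc) (v (Fin.last k)) := rfl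

theorem napp_add {k : ℕ} (P : Pred (k + 1)) (S : KState) (v : Fin k → ℕ) (m : ℕ) :
    napp k (A := .nat ⇾ .state) (learnInterp (.add P) S) v m = S.added P v m := by
  have := napp_ncurry (k + 1) (A := .state)
    (fun v => S.added P (fun i => v i.castSucc) (v (Fin.last k)))
    (Fin.snoc (α := fun _ => ℕ) v m)
  rw [← learnInterp_add, napp] at this
  simpa only [Fin.snoc_castSucc, Fin.snoc_last] using this

theorem LearnRule.eval_eq ⦃Γ : Ctx⦄ ⦃A : Ty⦄ (t u : TLearn Γ A) (h : LearnRule t u) (ε : Env Γ) :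
    t.eval learnInterp ε = u.eval learnInterp ε := by
  cases h with
  | chiTrue P S n h =>
    rw [eval_apps]
    simp only [Tm.eval, stTm, eval_num, learnInterp, napp_ncurry, h, decide_true]
  | chiFalse P S n h =>
    rw [eval_apps]
    simp only [Tm.eval, stTm, eval_num, learnInterp, napp_ncurry, h, decide_false]
  | phiFound S a h =>
    rw [eval_apps]
    simp only [Tm.eval, stTm, eval_num, learnInterp, napp_ncurry]
    exact S.witness_key a h
  | phiZero P S n h =>
    rw [eval_apps]
    simp only [Tm.eval, stTm, eval_num, learnInterp, napp_ncurry]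
    exact dif_neg h
  | addEmpty P S n m h =>
    rw [Tm.eval, eval_apps _ _ _ (A := .nat ⇾ .state)]
    simp only [Tm.eval, stTm, eval_num]
    rw [napp_add, KState.added, dif_neg]
    · rfl
    -- `P.at n m` cannot equal both truth values, since its value in the model is unique.
    · rintro ⟨h₁, h₂⟩
      rcases h with h | h
      · exact h₁ h
      · rw [eqT_tt_iff, eqT_ff_iff.1 h] at h₂
        exact Bool.false_ne_true h₂
  | addNew P S n m h h' =>
    rw [Tm.eval, eval_apps _ _ _ (A := .nat ⇾ .state)]
    simp only [Tm.eval, stTm, eval_num]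
    rw [napp_add, KState.added, dif_pos ⟨h', h⟩]
    rfl
  | cup S₁ S₂ => rfl

theorem EqLearn.eval_eq {Γ : Ctx} {A : Ty} {t u : TLearn Γ A} (h : EqLearn t u) (ε : Env Γ) :
    t.eval learnInterp ε = u.eval learnInterp ε :=
  Conv.eval_eq learnInterp LearnRule.eval_eq h ε

/-- On a state constant and numerals, the rules cover every case and return the canonical term of
the prescribed value. -/
theorem computes_learnConst ⦃A : Ty⦄ (c : LearnConst A) :
    Computes LearnRule (fun t S => EqLearn t (stTm S)) (.const c) (learnInterp c) := by
  have hQ : ∀ (t u : TLearn [] .state) (S : KState), EqLearn t u → EqLearn u (stTm S) →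
    EqLearn t (stTm S) := fun _ _ _ h h' => h.trans h'
  cases c with
  | st S => exact Conv.refl _
  | cup => exact fun t S ht u T hu => (((Conv.refl _).app ht).app hu).trans (.rule (.cup S T))
  | chi P =>
    intro t S ht
    refine Computes.of_conv hQ ((Conv.refl _).app ht) (Computes.ncurry hQ _ _ _ fun v => ?_)
    by_cases h : S.Knows ⟨_, P, v⟩
    · simp only [h, decide_true]
      exact Conv.rule (.chiTrue P S v h)
    · simp only [h, decide_false]
      exact Conv.rule (.chiFalse P S v h)
  | phi P =>
    intro t S ht
    refine Computes.of_conv hQ ((Conv.refl _).app ht) (Computes.ncurry hQ _ _ _ fun v => ?_)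
    by_cases h : S.Knows ⟨_, P, v⟩
    · obtain ⟨⟨k, P, v, m, hm⟩, ha, ha'⟩ := h
      cases ha'
      rw [show S.witness ⟨k, P, v⟩ = m from S.witness_key _ ha]
      exact Conv.rule (.phiFound S _ ha)
    · rw [KState.witness, dif_neg h]
      exact Conv.rule (.phiZero P S v h)
  | @add k P =>
    intro t S ht
    refine Computes.of_conv hQ ((Conv.refl _).app ht) ?_
    rw [learnInterp_add]
    refine Computes.ncurry hQ (k + 1) (A := .state) _ _ fun v => ?_
    by_cases h : ¬ S.Knows ⟨_, P, fun i => v i.castSucc⟩ ∧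
      EqT (P.at (fun i => v i.castSucc) (v (Fin.last k))) .tt
    · rw [KState.added, dif_pos h]
      exact Conv.rule (.addNew P S _ _ h.2 h.1)
    · rw [KState.added, dif_neg h]
      refine Conv.rule (.addEmpty P S _ _ ?_)
      -- The remaining case is covered by `addEmpty` because a closed boolean term of `T` that is
      -- not `tt` equals `ff`.
      rw [not_and_or, not_not] at h
      refine h.imp_right fun h => ?_
      rw [eqT_tt_iff, Bool.not_eq_true] at h
      exact eqT_ff_iff.2 h

theorem computes_learn {A : Ty} (t : TLearn [] A) :
    Computes LearnRule (fun t S => EqLearn t (stTm S)) t (t.eval learnInterp Env.nil) :=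
  Computes.eval (Q := fun t S => EqLearn t (stTm S)) (fun _ _ _ h h' => h.trans h')
    computes_learnConst t

/-- One direction is soundness of the model, the other is the fundamental lemma; the same holds for
the two analogues below. -/
theorem eqLearn_num_iff {t : TLearn [] .nat} {n : ℕ} :
    EqLearn t (num n) ↔ t.eval learnInterp Env.nil = n := by
  refine ⟨fun h => by rw [EqLearn.eval_eq h, eval_num], fun h => ?_⟩
  have : EqLearn t (num _) := computes_learn t
  rwa [h] at this

theorem eqLearn_boolTm_iff {t : TLearn [] .bool} {b : Bool} :
    EqLearn t (boolTm b) ↔ t.eval learnInterp Env.nil = b := by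
  refine ⟨fun h => by rw [EqLearn.eval_eq h, eval_boolTm], fun h => ?_⟩
  have : EqLearn t (boolTm _) := computes_learn t
  rwa [h] at this

theorem eqLearn_stTm_iff {t : TLearn [] .state} {S : KState} :
    EqLearn t (stTm S) ↔ t.eval learnInterp Env.nil = S := by
  refine ⟨fun h => EqLearn.eval_eq h _, fun h => ?_⟩
  have : EqLearn t (stTm _) := computes_learn t
  rwa [h] at this

/-! ## Realizability in the model -/

/-- Realizability of a formula by an element of the model, where the realizers of the premise of an
implication are restricted to the elements satisfying `D`. -/
def Formula.Sat (I : Interp K) (D : ∀ ⦃A : Ty⦄, A.den → Prop) :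
    ∀ {n : ℕ} {τ : Ty}, Formula K n τ → Env (nats n) → τ.den → Prop
  | _, _, .atom b, ε, a => a = KState.empty → b.1.eval I ε = true
  | _, _, .and A B, ε, a => A.Sat I D ε a.1 ∧ B.Sat I D ε a.2
  | _, _, .or A B, ε, a =>
      (a.1 = true ∧ A.Sat I D ε a.2.1) ∨ (a.1 = false ∧ B.Sat I D ε a.2.2)
  | _, _, .imp A B, ε, a => ∀ u, D u → A.Sat I D ε u → B.Sat I D ε (a u)
  | _, _, .all A, ε, a => ∀ k : ℕ, A.Sat I D (Env.cons (B := .nat) k ε) (a k)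
  | _, _, .ex A, ε, a => A.Sat I D (Env.cons (B := .nat) a.1 ε) a.2

theorem Formula.sat_subst (I : Interp K) (D : ∀ ⦃A : Ty⦄, A.den → Prop) {n m : ℕ} {τ : Ty}
    (A : Formula K n τ) (σ : Subst K (nats n) (nats m)) (ε : Env (nats m)) (a : τ.den) :
    (A.subst σ).Sat I D ε a ↔ A.Sat I D (fun _ x => (σ x).eval I ε) a := by
  induction A generalizing m with
  | atom b => simp only [Formula.subst, Formula.Sat, Atomic.subst, Tm.eval_subst]
  | and A B ihA ihB => simp only [Formula.subst, Formula.Sat, ihA, ihB]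
  | or A B ihA ihB => simp only [Formula.subst, Formula.Sat, ihA, ihB]
  | imp A B ihA ihB => simp only [Formula.subst, Formula.Sat, ihA, ihB]
  | @all n τ A ih =>
    refine forall_congr' fun k => ?_
    rw [← Env.cons_subst_lift]
    exact ih (m := m + 1) σ.lift _ _
  | @ex n τ A ih =>
    refine Iff.trans (ih (m := m + 1) σ.lift _ _) ?_
    rw [Env.cons_subst_lift]
    rfl

theorem Formula.sat_inst (I : Interp K) (D : ∀ ⦃A : Ty⦄, A.den → Prop) {n : ℕ} {τ : Ty}
    (A : Formula K (n + 1) τ) (t : Tm K (nats n) .nat) (ε : Env (nats n)) (a : τ.den) :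
    (A.inst t).Sat I D ε a ↔ A.Sat I D (Env.cons (B := .nat) (t.eval I ε) ε) a := by
  rw [Formula.inst, Formula.sat_subst, Env.inst]

theorem Env.sucLast (I : Interp K) {Γ : Ctx} (k : ℕ) (ε : Env Γ) :
    (fun _ x => (Subst.sucLast x : Tm K (.nat :: Γ) _).eval I (Env.cons (B := .nat) k ε) :
      Env (.nat :: Γ)) = Env.cons (B := .nat) (k + 1) ε := by
  funext A x
  cases x <;> rfl

theorem Formula.sat_weaken (I : Interp K) (D : ∀ ⦃A : Ty⦄, A.den → Prop) {n : ℕ} {τ : Ty}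
    (A : Formula K n τ) (k : ℕ) (ε : Env (nats n)) (a : τ.den) :
    A.weaken.Sat I D (Env.cons (B := .nat) k ε) a ↔ A.Sat I D ε a :=
  Formula.sat_subst (m := n + 1) I D A _ _ a

theorem Formula.sat_ofClosed (I : Interp K) (D : ∀ ⦃A : Ty⦄, A.den → Prop) {n : ℕ} {τ : Ty}
    (A : Formula K 0 τ) (ε : Env (nats n)) (a : τ.den) :
    (A.ofClosed : Formula K n τ).Sat I D ε a ↔ A.Sat I D Env.nil a := by
  rw [Formula.ofClosed, Formula.sat_subst, Env.eq_nil (fun _ _ => _)]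

theorem Formula.sat_alls (I : Interp K) (D : ∀ ⦃A : Ty⦄, A.den → Prop) : ∀ (k : ℕ) {τ : Ty}
    (A : Formula K k τ) (a : (natArrow k τ).den),
    (Formula.alls k A).Sat I D Env.nil a ↔ ∀ v, A.Sat I D (natsEnv v) (napp k a v)
  | 0, _, A, a => by
    have h : ∀ v : Fin 0 → ℕ, natsEnv v = Env.nil := fun v => Env.eq_nil (natsEnv v)
    simp only [Formula.alls, napp, h, forall_const]
  | k + 1, τ, A, a => by
    rw [Formula.alls, Formula.sat_alls I D k (.all A) a]
    refine ⟨fun h v => ?_, fun h v x => ?_⟩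
    · rw [natsEnv_succ]
      exact h _ _
    · have := h (Fin.snoc (α := fun _ => ℕ) v x)
      rw [natsEnv_succ, napp] at this
      simpa only [Fin.snoc_castSucc, Fin.snoc_last] using this

/-- The interpretation of the constants of `T_Class` at a state. -/
noncomputable def classInterp (s : KState) : Interp ClassConst :=
  fun _ c => (approxConst s c).eval learnInterp Env.nil

theorem Tm.eval_approx (s : KState) {Γ : Ctx} {A : Ty} (t : TClass Γ A) (ε : Env Γ) :
    (t.approx s).eval learnInterp ε = t.eval (classInterp s) ε :=
  Tm.eval_replaceConst _ _ _ _

/-- The elements of the model denoted at the state `s` by closed terms of `T_Class`. -/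
def Definable (s : KState) ⦃A : Ty⦄ (a : A.den) : Prop :=
  ∃ u : TClass [] A, u.eval (classInterp s) Env.nil = a

/-- Closed terms denoting the values of the variables are substituted into `t`. This closure keeps
realizers built from definable ones inside the range over which implications quantify. -/
theorem Definable.eval {s : KState} {Γ : Ctx} {A : Ty} (t : TClass Γ A) {ε : Env Γ}
    (h : ∀ ⦃A : Ty⦄ (x : Var Γ A), Definable s (ε x)) :
    Definable s (t.eval (classInterp s) ε) := by
  choose σ hσ using h
  exact ⟨t.subst σ, by rw [Tm.eval_subst]; simp only [hσ]⟩

theorem Definable.app {s : KState} {A B : Ty} {f : (A ⇾ B).den} {a : A.den}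
    (hf : Definable s f) (ha : Definable s a) : Definable s (f a) := by
  obtain ⟨t, rfl⟩ := hf
  obtain ⟨u, rfl⟩ := ha
  exact ⟨.app t u, rfl⟩

theorem Definable.cons {s : KState} {Γ : Ctx} {B : Ty} {b : B.den} {ε : Env Γ}
    (hb : Definable s b) (h : ∀ ⦃A : Ty⦄ (x : Var Γ A), Definable s (ε x)) :
    ∀ ⦃A : Ty⦄ (x : Var (B :: Γ) A), Definable s (Env.cons b ε x)
  | _, .zero => hb
  | _, .succ x => h x

theorem Definable.nat (s : KState) (n : ℕ) : Definable s (A := .nat) n := ⟨num n, eval_num _ n _⟩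

/-- Realizability over `T_Class` in the model, at the state `s`. -/
abbrev LClass.Sat (s : KState) {n : ℕ} {τ : Ty} (A : LClass n τ) (ε : Env (nats n)) (a : τ.den) :
    Prop :=
  Formula.Sat (classInterp s) (Definable s) A ε a

/-- Constants occur only in the atoms, and the same range `Definable s` is used for premises on both
sides. -/
theorem Formula.sat_approx (s : KState) {n : ℕ} {τ : Ty} (A : LClass n τ) (ε : Env (nats n))
    (a : τ.den) : (A.approx s).Sat learnInterp (Definable s) ε a ↔ LClass.Sat s A ε a := by
  unfold LClass.Sat
  induction A <;> simp_all only [Formula.approx, Formula.Sat, Tm.eval_approx]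

/-- The admissible premises $u'[s]$ have as values exactly the elements of `Definable s`. The
recursion is on `size` because an instance of `A` is not a structural part of the quantified
formula. -/
theorem realizes_iff_sat (s : KState) {τ : Ty} (t : TLearn [] τ) (A : LLearn 0 τ) :
    Realizes s t A ↔ A.Sat learnInterp (Definable s) Env.nil (t.eval learnInterp Env.nil) := by
  match τ, t, A with
  | _, t, .atom b =>
    rw [Realizes, Formula.Sat, eqLearn_stTm_iff]
    exact Iff.imp Iff.rfl (eqLearn_boolTm_iff (b := true))
  | _, t, .and A B =>
    rw [Realizes, Formula.Sat, realizes_iff_sat s _ A, realizes_iff_sat s _ B]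
    rfl
  | _, t, .or A B =>
    rw [Realizes, Formula.Sat, realizes_iff_sat s _ A, realizes_iff_sat s _ B]
    exact Iff.or (Iff.and (eqLearn_boolTm_iff (b := true)) Iff.rfl)
      (Iff.and (eqLearn_boolTm_iff (b := false)) Iff.rfl)
  | _, t, .imp A B =>
    rw [Realizes, Formula.Sat]
    constructor
    · rintro h _ ⟨u, rfl⟩ hu
      have := h u
      rw [realizes_iff_sat s _ A, realizes_iff_sat s _ B, Tm.eval, Tm.eval_approx] at this
      exact this hu
    · intro h u
      rw [realizes_iff_sat s _ A, realizes_iff_sat s _ B, Tm.eval, Tm.eval_approx]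
      exact h _ ⟨u, rfl⟩
  | _, t, .all A =>
    rw [Realizes, Formula.Sat]
    refine forall_congr' fun k => ?_
    rw [realizes_iff_sat s _ (A.inst (num k)), Formula.sat_inst, Tm.eval, eval_num]
  | _, t, .ex A =>
    rw [Realizes, Formula.Sat]
    -- The first projection equals only the numeral of its own value, so the quantifier over
    -- numerals collapses.
    have key : ∀ n : ℕ, (EqLearn (.fst t) (num n) ∧ Realizes s (.snd t) (A.inst (num n))) ↔
        (n = (t.eval learnInterp Env.nil).1 ∧ A.Sat learnInterp (Definable s)
          (Env.cons (B := .nat) n Env.nil) (t.eval learnInterp Env.nil).2) := fun n => by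
      rw [realizes_iff_sat s _ (A.inst (num n)), Formula.sat_inst, eval_num, eqLearn_num_iff, eq_comm]
      rfl
    simp only [key, exists_eq_left]
termination_by A.size
decreasing_by all_goals simp only [Formula.size, Formula.size_inst]; omega

/-- The right-hand side is the one obtained from $t[s] \Vdash_s A[s]$, so the two notions of
realizability agree at `s`. -/
theorem classRealizesAt_iff_sat (s : KState) {τ : Ty} (t : TClass [] τ) (A : LClass 0 τ) :
    ClassRealizesAt s t A ↔ LClass.Sat s A Env.nil (t.eval (classInterp s) Env.nil) := by
  unfold LClass.Sat
  match τ, t, A with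
  | _, t, .atom b =>
    rw [ClassRealizesAt, Formula.Sat, eqLearn_stTm_iff, Tm.eval_approx]
    refine Iff.imp Iff.rfl ((eqLearn_boolTm_iff (b := true)).trans ?_)
    rw [Tm.eval_approx]
  | _, t, .and A B =>
    rw [ClassRealizesAt, Formula.Sat, classRealizesAt_iff_sat s _ A,
      classRealizesAt_iff_sat s _ B]
    rfl
  | _, t, .or A B =>
    rw [ClassRealizesAt, Formula.Sat, classRealizesAt_iff_sat s _ A,
      classRealizesAt_iff_sat s _ B]
    refine Iff.or (Iff.and ((eqLearn_boolTm_iff (b := true)).trans ?_) Iff.rfl)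
      (Iff.and ((eqLearn_boolTm_iff (b := false)).trans ?_) Iff.rfl) <;>
    · rw [Tm.eval_approx]
      rfl
  | _, t, .imp A B =>
    rw [ClassRealizesAt, Formula.Sat]
    constructor
    · rintro h _ ⟨u, rfl⟩ hu
      have := h u
      rw [classRealizesAt_iff_sat s _ A, classRealizesAt_iff_sat s _ B, Tm.eval] at this
      exact this hu
    · intro h u
      rw [classRealizesAt_iff_sat s _ A, classRealizesAt_iff_sat s _ B, Tm.eval]
      exact h _ ⟨u, rfl⟩
  | _, t, .all A =>
    rw [ClassRealizesAt, Formula.Sat]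
    refine forall_congr' fun k => ?_
    rw [classRealizesAt_iff_sat s _ (A.inst (num k)), LClass.Sat, Formula.sat_inst, Tm.eval,
      eval_num]
  | _, t, .ex A =>
    rw [ClassRealizesAt, Formula.Sat]
    have key : ∀ n : ℕ, (EqLearn ((Tm.fst t).approx s) (num n) ∧
        ClassRealizesAt s (.snd t) (A.inst (num n))) ↔
        (n = (t.eval (classInterp s) Env.nil).1 ∧ A.Sat (classInterp s) (Definable s)
          (Env.cons (B := .nat) n Env.nil) (t.eval (classInterp s) Env.nil).2) := fun n => by
      rw [classRealizesAt_iff_sat s _ (A.inst (num n)), LClass.Sat, Formula.sat_inst, eval_num,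
        eqLearn_num_iff, Tm.eval_approx, eq_comm]
      rfl
    simp only [key, exists_eq_left]
termination_by A.size
decreasing_by all_goals simp only [Formula.size, Formula.size_inst]; omega

/-! ## Soundness of the atomic rules -/

theorem eval_eqTm (I : Interp K) (ε : Env []) (x y : ℕ) :
    (eqTm : Tm K [] _).eval I ε x y = decide (x = y) := by
  induction x generalizing y with
  | zero => cases y <;> rfl
  | succ x ih =>
    cases y with
    | zero => rfl
    | succ y => exact (ih y).trans (by simp only [Nat.add_right_cancel_iff])

theorem eval_leTm (I : Interp K) (ε : Env []) (x y : ℕ) :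
    (leTm : Tm K [] _).eval I ε x y = decide (x ≤ y) := by
  induction x generalizing y with
  | zero => exact (decide_eq_true (Nat.zero_le y)).symm
  | succ x ih =>
    cases y with
    | zero => rfl
    | succ y => exact (ih y).trans (by simp only [Nat.add_le_add_iff_right])

theorem Atomic.eval_mk (I : Interp K) {m n : ℕ} (Q : Tm K [] (natArrow m .bool))
    (ts : Fin m → Tm K (nats n) .nat) (ε : Env (nats n)) :
    (Atomic.mk Q ts).1.eval I ε = napp m (Q.eval I Env.nil) (fun i => (ts i).eval I ε) := by
  rw [Atomic.mk, eval_apps, Tm.eval_ofClosed]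

theorem eval_eqAtom (I : Interp ClassConst) {n : ℕ} (t u : LTerm n) (ε : Env (nats n)) :
    (eqAtom t u).1.eval I ε = true ↔ t.eval I ε = u.eval I ε := by
  rw [eqAtom, Atomic.eval_mk]
  exact (Bool.eq_iff_iff.1 (eval_eqTm I _ _ _)).trans decide_eq_true_iff

theorem eval_leAtom (I : Interp ClassConst) {n : ℕ} (t u : LTerm n) (ε : Env (nats n)) :
    (leAtom t u).1.eval I ε = true ↔ @LE.le ℕ _ (t.eval I ε) (u.eval I ε) := by
  rw [leAtom, Atomic.eval_mk]
  exact (Bool.eq_iff_iff.1 (eval_leTm I _ _ _)).trans decide_eq_true_iff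

theorem eval_bnot (I : Interp K) {Γ : Ctx} (b : Tm K Γ .bool) (ε : Env Γ) :
    (Tm.bnot b).eval I ε = !(b.eval I ε) := by
  change cond (b.eval I ε) false true = _
  cases b.eval I ε <;> rfl

theorem eval_band (I : Interp K) {Γ : Ctx} (b c : Tm K Γ .bool) (ε : Env Γ) :
    (Tm.band b c).eval I ε = (b.eval I ε && c.eval I ε) := by
  change cond (b.eval I ε) (c.eval I ε) false = _
  cases b.eval I ε <;> rfl

theorem eval_bor (I : Interp K) {Γ : Ctx} (b c : Tm K Γ .bool) (ε : Env Γ) :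
    (Tm.bor b c).eval I ε = (b.eval I ε || c.eval I ε) := by
  change cond (b.eval I ε) true (c.eval I ε) = _
  cases b.eval I ε <;> rfl

theorem eval_bimp (I : Interp K) {Γ : Ctx} (b c : Tm K Γ .bool) (ε : Env Γ) :
    (Tm.bimp b c).eval I ε = (!(b.eval I ε) || c.eval I ε) := by
  change cond (b.eval I ε) (c.eval I ε) true = _
  cases b.eval I ε <;> rfl

/-- The value of a boolean expression under an assignment. -/
def BoolForm.val {k : ℕ} (v : Fin k → Bool) : BoolForm k → Bool
  | .var i => v i
  | .true => Bool.true
  | .false => Bool.false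
  | .not φ => !(φ.val v)
  | .and φ ψ => φ.val v && ψ.val v
  | .or φ ψ => φ.val v || ψ.val v
  | .imp φ ψ => !(φ.val v) || ψ.val v

theorem BoolForm.eval_toTm (I : Interp K) {k : ℕ} {Γ : Ctx} (p : Fin k → Tm K Γ .bool) (ε : Env Γ)
    (φ : BoolForm k) : (φ.toTm p).eval I ε = φ.val (fun i => (p i).eval I ε) := by
  induction φ with
  | var i => rfl
  | true => rfl
  | false => rfl
  | not φ ih => rw [BoolForm.toTm, eval_bnot, ih, BoolForm.val]
  | and φ ψ ihφ ihψ => rw [BoolForm.toTm, eval_band, ihφ, ihψ, BoolForm.val]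
  | or φ ψ ihφ ihψ => rw [BoolForm.toTm, eval_bor, ihφ, ihψ, BoolForm.val]
  | imp φ ψ ihφ ihψ => rw [BoolForm.toTm, eval_bimp, ihφ, ihψ, BoolForm.val]

/-- Since equality to `tt` in `T` is truth in the model, the syntactic notion is ordinary
tautological consequence. -/
theorem TautConsequence.val {k m : ℕ} {φ : Fin m → BoolForm k} {ψ : BoolForm k}
    (h : TautConsequence φ ψ) (v : Fin k → Bool) (hφ : ∀ i, (φ i).val v = true) :
    ψ.val v = true := by
  simpa only [eqT_tt_iff, BoolForm.eval_toTm, eval_boolTm] using h v (by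
    simpa only [eqT_tt_iff, BoolForm.eval_toTm, eval_boolTm] using hφ)

/-- The rules hold over the standard natural numbers whatever the oracles and Skolem maps mean; no
state is involved. -/
theorem PostRule.sound (I : Interp ClassConst) {n m : ℕ} {B : Fin m → Atomic ClassConst n}
    {C : Atomic ClassConst n} (h : PostRule B C) (ε : Env (nats n))
    (hB : ∀ i, (B i).1.eval I ε = true) : C.1.eval I ε = true := by
  cases h with
  | taut p φ ψ h _ _ hB' hC =>
    rw [EqT.eval_eq I hC, BoolForm.eval_toTm]
    refine h.val _ fun i => ?_
    rw [← BoolForm.eval_toTm, ← EqT.eval_eq I (hB' i)]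
    exact hB i
  | equation t u h => exact (eval_eqAtom ..).2 (EqT.eval_eq I h ε)
  | eqSymm t u => exact (eval_eqAtom ..).2 ((eval_eqAtom ..).1 (hB 0)).symm
  | eqTrans t u v =>
    exact (eval_eqAtom ..).2 (((eval_eqAtom ..).1 (hB 0)).trans ((eval_eqAtom ..).1 (hB 1)))
  | eqSubst t u C =>
    have h₁ : (C.subst (Subst.inst t)).1.eval I ε = true := hB 1
    rw [Atomic.subst, Tm.eval_subst, Env.inst] at h₁ ⊢
    rw [← (eval_eqAtom I t u ε).1 (hB 0)]
    exact h₁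
  | sucNeZero t => exact absurd ((eval_eqAtom ..).1 (hB 0)) (Nat.succ_ne_zero _)
  | sucInj t u => exact (eval_eqAtom ..).2 (Nat.succ_injective ((eval_eqAtom ..).1 (hB 0)))
  | zeroLe t => exact (eval_leAtom ..).2 (Nat.zero_le _)
  | sucLeZero t => exact absurd ((eval_leAtom ..).1 (hB 0)) (Nat.not_succ_le_zero _)
  | sucLeSuc t u => exact (eval_leAtom ..).2 (Nat.succ_le_succ ((eval_leAtom ..).1 (hB 0)))
  | leOfSucLeSuc t u =>
    exact (eval_leAtom ..).2 (Nat.le_of_succ_le_succ ((eval_leAtom ..).1 (hB 0)))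
  | leOfEq t u => exact (eval_leAtom ..).2 (Nat.le_of_eq ((eval_eqAtom ..).1 (hB 0)))
  | leTrans t u v =>
    exact (eval_leAtom ..).2 (Nat.le_trans ((eval_leAtom ..).1 (hB 0)) ((eval_leAtom ..).1 (hB 1)))
  | leAntisymm t u =>
    exact (eval_eqAtom ..).2
      (Nat.le_antisymm ((eval_leAtom ..).1 (hB 0)) ((eval_leAtom ..).1 (hB 1)))
  | leTotal t u _ h =>
    rw [EqT.eval_eq I h, eval_bor, Bool.or_eq_true, eval_leAtom, eval_leAtom]
    exact Nat.le_total _ _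

/-- If the realizer of the conclusion of a Post rule is empty, so are those of all premises, which
are therefore true. -/
theorem eval_cups_eq_empty (s : KState) {Γ : Ctx} (ε : Env Γ) : ∀ {m : ℕ}
    (u : Fin m → TClass Γ .state), (cups u).eval (classInterp s) ε = KState.empty →
    ∀ i, (u i).eval (classInterp s) ε = KState.empty
  | 0, _, _, i => i.elim0
  | 1, _, h, i => by rwa [Subsingleton.elim i 0]
  | m + 2, u, h, i => by
    have h' := KState.cup_eq_empty (S := (cups fun i => u i.castSucc).eval (classInterp s) ε) h
    refine Fin.lastCases h'.2 (fun i => ?_) i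
    exact eval_cups_eq_empty s ε (fun i => u i.castSucc) h'.1 i

/-! ## The axioms for the oracles and the Skolem maps -/

theorem napp_Chi (s : KState) {k : ℕ} (P : Pred (k + 1)) (v : Fin k → ℕ) :
    napp k (A := .bool) (classInterp s (.Chi P)) v = true ↔ s.Knows ⟨k, P, v⟩ := by
  have : napp k (A := .bool) (classInterp s (.Chi P)) v =
      @decide (s.Knows ⟨k, P, v⟩) (Classical.propDecidable _) :=
    napp_ncurry k (A := .bool) _ v
  rw [this]
  exact @decide_eq_true_iff _ (Classical.propDecidable _)

theorem napp_Phi (s : KState) {k : ℕ} (P : Pred (k + 1)) (v : Fin k → ℕ) :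
    napp k (A := .nat) (classInterp s (.Phi P)) v = s.witness ⟨k, P, v⟩ :=
  napp_ncurry k (A := .nat) _ v

theorem napp_Add (s : KState) {k : ℕ} (P : Pred (k + 1)) (v : Fin k → ℕ) (m : ℕ) :
    napp k (A := .nat ⇾ .state) (classInterp s (.Add P)) v m = s.added P v m :=
  napp_add P s v m

/-- Each atom carries a proof that its predicate holds, so whatever a state knows is true. -/
theorem KState.val_witness {s : KState} {k : ℕ} {P : Pred (k + 1)} {v : Fin k → ℕ}
    (h : s.Knows ⟨k, P, v⟩) :
    P.val (Fin.snoc (α := fun _ => ℕ) v (s.witness ⟨k, P, v⟩)) = true := by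
  obtain ⟨a, ha, hk⟩ := h
  have ha' := s.witness_key a ha
  obtain ⟨k, P, v, m, hm⟩ := a
  cases hk
  rw [EMAtom.key] at ha'
  rw [ha']
  exact EMAtom.val_eq_true ⟨k, P, v, m, hm⟩

/-- This is the learning step: for a true instance not yet known, `added` is a singleton. An empty
answer at a true instance therefore means that the state already had a witness. -/
theorem KState.knows_of_added_eq_empty {s : KState} {k : ℕ} {P : Pred (k + 1)} {v : Fin k → ℕ}
    {m : ℕ} (h : s.added P v m = KState.empty)
    (hP : P.val (Fin.snoc (α := fun _ => ℕ) v m) = true) : s.Knows ⟨k, P, v⟩ := by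
  by_contra hk
  rw [KState.added, dif_pos ⟨hk, eqT_tt_iff.2 (by rw [Pred.eval_at, hP])⟩] at h
  exact KState.single_ne_empty _ h

theorem eval_apps_natVars (I : Interp K) {k : ℕ} {A : Ty} (t : Tm K (nats k) (natArrow k A))
    (v : Fin k → ℕ) :
    (apps k t (natVars k)).eval I (natsEnv v) = napp k (t.eval I (natsEnv v)) v := by
  rw [eval_apps]
  simp only [eval_natVars]

theorem eval_chiAtom (s : KState) {k n : ℕ} (P : Pred (k + 1)) (ts : Fin k → LTerm n) (t : LTerm n)
    (ε : Env (nats n)) : (chiAtom P ts t).1.eval (classInterp s) ε =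
      (!(P.val (Fin.snoc (α := fun _ => ℕ) (fun i => (ts i).eval (classInterp s) ε)
        (t.eval (classInterp s) ε))) ||
      napp k (A := .bool) (classInterp s (.Chi P)) (fun i => (ts i).eval (classInterp s) ε)) := by
  rw [chiAtom, Atomic.eval_mk, napp_eval_lams, eval_bimp, eval_apps_natVars, Pred.eval_toTm,
    eval_apps]
  simp only [eval_natVars, Fin.snoc_castSucc, Tm.eval]
  congr 3
  funext i
  refine Fin.lastCases ?_ (fun i => ?_) i
  · simp only [Fin.snoc_last]
  · simp only [Fin.snoc_castSucc]

/-- If the oracle answers yes, the state contains an atom and the Skolem map returns its number;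
otherwise the implication is vacuous. Hence the axiom holds at every state and `∅` realizes it. -/
theorem eval_phiAtom (s : KState) {k n : ℕ} (P : Pred (k + 1)) (ts : Fin k → LTerm n)
    (ε : Env (nats n)) : (phiAtom P ts).1.eval (classInterp s) ε = true := by
  rw [phiAtom, Atomic.eval_mk, napp_eval_lams, eval_bimp, eval_apps_natVars]
  rw [Tm.eval_app, eval_apps_natVars (A := .nat ⇾ .bool), eval_apps_natVars (A := .nat),
    Pred.eval_toTm]
  simp only [Tm.eval, napp_Phi]
  rw [Bool.or_eq_true, Bool.not_eq_true', ← Bool.not_eq_true, ← imp_iff_not_or, napp_Chi]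
  intro h
  simpa only [Pred.val, napp, Fin.snoc_castSucc, Fin.snoc_last] using KState.val_witness h

theorem sat_em1 (s : KState) {k : ℕ} (P : Pred (k + 1)) :
    LClass.Sat s (em1 P) Env.nil ((em1Tm P).eval (classInterp s) Env.nil) := by
  unfold LClass.Sat
  rw [em1, Formula.sat_alls]
  intro v
  have hm : ∀ (Q : TClass [] (natArrow (k + 1) .bool)) (m : ℕ),
      (Atomic.mk (m := k + 1) Q (natVars (k + 1))).1.eval (classInterp s)
        (Env.cons (B := .nat) m (natsEnv v)) =
      napp (k + 1) (Q.eval (classInterp s) Env.nil) (Fin.snoc (α := fun _ => ℕ) v m) := by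
    intro Q m
    rw [Atomic.eval_mk, ← natsEnv_snoc]
    simp only [eval_natVars]
  rw [em1Tm, napp_eval_lams]
  simp only [Formula.Sat, hm]
  simp only [Tm.eval, eval_apps_natVars, napp_Phi]
  -- If the state knows a witness, the left disjunct holds outright. Otherwise the right one is
  -- claimed provisionally: at any counterexample `m`, `Add` would be nonempty.
  by_cases h : s.Knows ⟨k, P, v⟩
  · refine Or.inl ⟨(napp_Chi s P v).2 h, fun _ => ?_⟩
    rw [Pred.eval_toTm]
    exact KState.val_witness h
  · refine Or.inr ⟨Bool.eq_false_iff.2 (mt (napp_Chi s P v).1 h), fun m hm => ?_⟩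
    rw [napp_eval_lams, eval_bnot, eval_apps_natVars, Pred.eval_toTm, Bool.not_eq_true',
      ← Bool.not_eq_true]
    refine mt (KState.knows_of_added_eq_empty (m := m) ?_) h
    rw [← natsEnv_snoc, eval_apps_natVars (A := .state)] at hm
    simpa only [Tm.eval, napp, Fin.snoc_castSucc, Fin.snoc_last, napp_Add] using hm

/-! ## Adequacy -/

theorem sat_cons {s : KState} {n : ℕ} {Δ Ξ : Ctx} {σ : Ty} {G : Assumptions n Δ} {A : LClass n σ}
    {ρ : Ren Δ Ξ} {δ : Env (nats n)} {ε : Env Ξ} {a : σ.den} (hA : LClass.Sat s A δ a)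
    (hG : ∀ ⦃B : Ty⦄ (x : Var Δ B), LClass.Sat s (G x) δ (ε (ρ x))) :
    ∀ ⦃B : Ty⦄ (x : Var (σ :: Δ) B), LClass.Sat s (G.cons A x) δ (Env.cons a ε (ρ.lift x))
  | _, .zero => hA
  | _, .succ x => hG x

theorem sat_weaken_cons {s : KState} {n : ℕ} {Δ Ξ : Ctx} {G : Assumptions n Δ}
    {ρ : Ren Δ Ξ} {ν : Ren (nats n) Ξ} {ε : Env Ξ} (k : ℕ)
    (hG : ∀ ⦃B : Ty⦄ (x : Var Δ B), LClass.Sat s (G x) (fun _ y => ε (ν y)) (ε (ρ x))) ⦃B : Ty⦄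
    (x : Var Δ B) : LClass.Sat s (G.weaken x)
      (fun _ y => Env.cons (B := .nat) k ε (ν.lift y)) (Env.cons (B := .nat) k ε (ρ.wk x)) := by
  rw [Env.cons_lift]
  exact (Formula.sat_weaken _ _ (G x) k _ _).2 (hG x)

/-- Induction on the proof, for arbitrary `Ξ`, `ρ` and `ν` because binders enlarge the context. All
values in `ε` are kept definable, which is what the implication rules consume. -/
theorem Deriv.sat_decorate (s : KState) {n : ℕ} {Δ : Ctx} {τ : Ty} {G : Assumptions n Δ}
    {A : LClass n τ} (D : Deriv G A) {Ξ : Ctx} (ρ : Ren Δ Ξ) (ν : Ren (nats n) Ξ) (ε : Env Ξ)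
    (hε : ∀ ⦃B : Ty⦄ (x : Var Ξ B), Definable s (ε x))
    (hG : ∀ ⦃B : Ty⦄ (x : Var Δ B), LClass.Sat s (G x) (fun _ y => ε (ν y)) (ε (ρ x))) :
    LClass.Sat s A (fun _ y => ε (ν y)) ((D.decorate ρ ν).eval (classInterp s) ε) := by
  unfold LClass.Sat at *
  induction D generalizing Ξ with
  | ass x h => exact h ▸ hG x
  | andI D E ihD ihE => exact ⟨ihD ρ ν ε hε hG, ihE ρ ν ε hε hG⟩
  | andE₁ D ih => exact (ih ρ ν ε hε hG).1
  | andE₂ D ih => exact (ih ρ ν ε hε hG).2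
  | impI D ih =>
    intro u hu hA
    exact ih ρ.lift ν.wk _ (hu.cons hε) (sat_cons hA hG)
  -- The realizer of the premise is the value of a term at definable arguments, hence an admissible
  -- argument.
  | impE D E ihD ihE => exact ihD ρ ν ε hε hG _ (.eval _ hε) (ihE ρ ν ε hε hG)
  | orI₁ D ih => exact Or.inl ⟨rfl, ih ρ ν ε hε hG⟩
  | orI₂ D ih => exact Or.inr ⟨rfl, ih ρ ν ε hε hG⟩
  | orE D E₁ E₂ ihD ih₁ ih₂ =>
    rcases ihD ρ ν ε hε hG with ⟨hb, h⟩ | ⟨hb, h⟩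
    · have := ih₁ ρ.lift ν.wk (Env.cons _ ε)
        ((Definable.eval (Tm.p1 (D.decorate ρ ν)) hε).cons hε) (sat_cons h hG)
      simp only [Deriv.decorate, Tm.cond, Tm.eval, Tm.p0, hb]
      exact this
    · have := ih₂ ρ.lift ν.wk (Env.cons _ ε)
        ((Definable.eval (Tm.p2 (D.decorate ρ ν)) hε).cons hε) (sat_cons h hG)
      simp only [Deriv.decorate, Tm.cond, Tm.eval, Tm.p0, hb]
      exact this
  | allI D ih =>
    intro k
    have := ih ρ.wk ν.lift _ ((Definable.nat s k).cons hε) (sat_weaken_cons k hG)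
    rwa [Env.cons_lift] at this
  | allE D t ih =>
    rw [Formula.sat_inst, ← Tm.eval_rename]
    exact ih ρ ν ε hε hG _
  | exI t D ih =>
    have := ih ρ ν ε hε hG
    rw [Formula.sat_inst, ← Tm.eval_rename] at this
    exact this
  | @exE n Δ G σ τ A C D E ihD ihE =>
    have h := ihD ρ ν ε hε hG
    have := ihE ρ.wk.lift (Ren.wk ν.lift) _
      ((Definable.eval (.snd (D.decorate ρ ν)) hε).cons
        ((Definable.nat s ((D.decorate ρ ν).eval (classInterp s) ε).1).cons hε)) ?_
    · exact (Formula.sat_weaken _ _ C _ _ _).1 ((Env.cons_lift _ ν ε) ▸ this)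
    · refine sat_cons ?_ (sat_weaken_cons _ hG)
      have h' := Env.cons_lift (B := .nat) ((D.decorate ρ ν).eval (classInterp s) ε).1 ν ε
      exact h' ▸ h
  | @ind n Δ G τ A D E ihD ihE =>
    intro k
    -- The assumptions do not see the new variable `k`, which `ν.wk` and `ρ.wk` skip, so `hG` serves
    -- unchanged.
    have hG' : ∀ ⦃B : Ty⦄ (x : Var Δ B), Formula.Sat (classInterp s) (Definable s) (G x)
      (fun _ y => (Env.cons (B := .nat) k ε) (ν.wk y)) ((Env.cons (B := .nat) k ε) (ρ.wk x)) := hG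
    have hk := (Definable.nat s k).cons hε
    have h₀ := ihD ρ.wk ν.wk _ hk hG'
    have h₁ := ihE ρ.wk ν.wk _ hk hG'
    rw [Formula.sat_inst] at h₀
    have hD := Definable.eval (D.decorate ρ.wk ν.wk) hk
    have hE := Definable.eval (E.decorate ρ.wk ν.wk) hk
    -- Definability is proved together with realizability, because the induction step is an
    -- implication that accepts only definable realizers.
    have hj : ∀ j : ℕ, Definable s (Nat.rec ((D.decorate ρ.wk ν.wk).eval (classInterp s)
          (Env.cons (B := .nat) k ε)) ((E.decorate ρ.wk ν.wk).eval (classInterp s)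
          (Env.cons (B := .nat) k ε)) j : τ.den) ∧
        Formula.Sat (classInterp s) (Definable s) A (Env.cons (B := .nat) j (fun _ y => ε (ν y)))
          (Nat.rec ((D.decorate ρ.wk ν.wk).eval (classInterp s)
          (Env.cons (B := .nat) k ε)) ((E.decorate ρ.wk ν.wk).eval (classInterp s)
          (Env.cons (B := .nat) k ε)) j : τ.den) := by
      intro j
      induction j with
      | zero => exact ⟨hD, h₀⟩
      | succ j ihj =>
        refine ⟨(hE.app (Definable.nat s j)).app ihj.1, ?_⟩
        have := (Formula.sat_subst (m := n + 1) _ _ A _ _ _).1 (h₁ j _ ihj.1 ihj.2)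
        rw [Env.sucLast] at this
        exact this
    exact (hj k).2
  | post h D ih =>
    intro he
    exact h.sound _ _ fun i => ih i ρ ν ε hε hG (eval_cups_eq_empty s ε _ he i)
  | em1 P =>
    rw [Formula.sat_ofClosed]
    simp only [Deriv.decorate, Tm.eval_ofClosed]
    exact sat_em1 s P
  | chi P ts t =>
    intro he
    rw [eval_chiAtom, Bool.or_eq_true, Bool.not_eq_true', ← Bool.not_eq_true, ← imp_iff_not_or,
      napp_Chi]
    -- The realizer is `Add` itself: if it is empty and the instance of `P` is true, the state has a
    -- witness and the oracle answers yes.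
    refine KState.knows_of_added_eq_empty ?_
    simp only [Deriv.decorate, Tm.eval] at he
    rw [eval_apps _ _ _ (A := .nat ⇾ .state)] at he
    simpa only [Tm.eval, Tm.eval_rename, napp_Add] using he
  | phi P ts => exact fun _ => eval_phiAtom s P ts _

theorem Subst.append_inl : ∀ {Γ Δ Θ : Ctx} (σ : Subst K Γ Θ) (τ : Subst K Δ Θ) ⦃A : Ty⦄
    (x : Var Γ A), Subst.append σ τ (Ren.inl x) = σ x
  | _ :: _, _, _, _, _, _, .zero => rfl
  | _ :: _, _, _, σ, τ, _, .succ x => Subst.append_inl (fun _ y => σ (.succ y)) τ x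

theorem Subst.append_inr : ∀ {Γ Δ Θ : Ctx} (σ : Subst K Γ Θ) (τ : Subst K Δ Θ) ⦃A : Ty⦄
    (x : Var Δ A), Subst.append σ τ (Ren.inr (Γ := Γ) x) = τ x
  | [], _, _, _, _, _, _ => rfl
  | _ :: _, _, _, σ, τ, _, x => Subst.append_inr (fun _ y => σ (.succ y)) τ x

/-- Adequacy, in terms of the values of the realizers. -/
theorem Deriv.sat_star (s : KState) {n : ℕ} {Δ : Ctx} {τ : Ty} {G : Assumptions n Δ}
    {A : LClass n τ} (D : Deriv G A) (t : Subst ClassConst Δ []) (m : Subst ClassConst (nats n) [])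
    (h : ∀ ⦃σ : Ty⦄ (x : Var Δ σ), LClass.Sat s (G x)
      (fun _ y => (m y).eval (classInterp s) Env.nil) ((t x).eval (classInterp s) Env.nil)) :
    LClass.Sat s A (fun _ y => (m y).eval (classInterp s) Env.nil)
      ((D.star.subst (Subst.append t m)).eval (classInterp s) Env.nil) := by
  have := D.sat_decorate s Ren.inl Ren.inr
    (fun _ x => (Subst.append t m x).eval (classInterp s) Env.nil) (fun _ x => ⟨_, rfl⟩)
  simp only [Subst.append_inl, Subst.append_inr] at this
  rw [Tm.eval_subst]
  exact this h

end HAEM1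

/-! ### The theorem, read back from the model -/

theorem mainTheorem1 :
    (∀ (n : ℕ) (Δ : Ctx) (τ : Ty) (G : Assumptions n Δ) (A : LClass n τ) (D : Deriv G A)
        (s : KState) (t : Subst ClassConst Δ []) (m : Fin n → ℕ),
        (∀ (σ : Ty) (x : Var Δ σ),
          Realizes s ((t x).approx s) (((G x).subst (m := 0) (numSub m)).approx s)) →
        Realizes s ((D.star.subst (Subst.append t (numSub m))).approx s)
          ((A.subst (m := 0) (numSub m)).approx s)) ∧
    (∀ (τ : Ty) (A : LClass 0 τ) (D : Deriv Assumptions.none A), ClassRealizes D.star A) ∧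
    (∀ (τ : Ty) (A : LClass 0 τ), Provable A → ∃ t : TClass [] τ, ClassRealizes t A) := by
  refine ⟨fun n Δ τ G A D s t m h => ?_, fun τ A D s => ?_, fun τ A hA => ?_⟩
  · rw [realizes_iff_sat, Formula.sat_approx, Tm.eval_approx]
    refine (Formula.sat_subst (m := 0) _ _ A _ _ _).2
      (D.sat_star s t (numSub m) fun σ x => ?_)
    have := h σ x
    rw [realizes_iff_sat, Formula.sat_approx, Tm.eval_approx] at this
    exact (Formula.sat_subst (m := 0) _ _ (G x) _ _ _).1 this
  · rw [classRealizesAt_iff_sat]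
    -- Without assumptions and variables the context of `D.star` reduces to the empty one, so
    -- nothing has to be substituted.
    exact D.sat_decorate s Ren.inl Ren.inr Env.nil (fun _ x => nomatch x) (fun _ x => nomatch x)
  · obtain ⟨n, ⟨D⟩⟩ := hA
    -- Variables left free in the proof are set to `0`; any numerals would do, since the closed
    -- formula does not depend on them.
    refine ⟨D.star.subst (Subst.append (Γ := []) (fun _ x => nomatch x) (numSub fun _ => 0)),
      fun s => ?_⟩
    rw [classRealizesAt_iff_sat]
    have := D.sat_star s (fun _ x => nomatch x) (numSub fun _ => 0) (fun _ x => nomatch x)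
    exact (Formula.sat_ofClosed _ _ A _ _).1 this
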